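/- **Setting.** Let $d\in\{2,3\}$ and let $\Omega\subset\mathbb R^d$ be a bounded, connected, open set with Lipschitz boundary $\Gamma$. *Mesh.* Let $X=\{x_1,\dots,x_N\}$ be a cloud of distinct points, each lying in $\Omega$ (interior points) or on $\Gamma$ (boundary points), with a conforming dual mesh of $\Omega$ with affine faces. That is, each $x_i$ lies in a dual cell $\omega_i$; the cells are closures of their interiors, have pairwise disjoint interiors, and have union $\overline\Omega$. The boundary $\partial\omega_i$ is the union of the faces $f_{ij}=\partial\omega_i\cap\partial\omega_j$, where $j$ runs over the neighbours of $i$ (a symmetric relation), and, if $x_i$ is a boundary point, of the segment $\Gamma_i=\partial\omega_i\cap\Gamma$; $\Gamma$ is the union of the $\Gamma_i$. Each $f_{ij}$ and each $\Gamma_i$ lies in a hyperplane, has positive $(d-1)$-dimensional measure, and has a constant unit normal $n_{ij}$, resp. $n_i$, which is the outer normal of $\omega_i$ almost everywhere on it. Let $\mu_i=|\omega_i|$. Let $\gamma\subseteq\Gamma$ be a union of segments $\Gamma_i$ and $\gamma'$ the union of the other segments; by abuse of notation $i\in\gamma$ means that $\Gamma_i$ is one of the segments forming $\gamma$. A discrete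 field $u^h=(u^h_i)_{i\notin\gamma}$, $u^h_i\in\mathbb R^d$, consists of vectors at the points outside $\gamma$. *GMLS operator.* Let $\phi_1,\dots,\phi_{d+1}$ be a basis of the space $P_1$ of polynomials of degree at most one, and let $\boldsymbol\phi_s=e_k\phi_r$, $s=(k,r)$, be the resulting basis of $(P_1)^d$. Let $\kappa(\rho)=(1-\rho/\epsilon)_+^4$ with $\epsilon>0$. For each $f=f_{ij}$, and for each $f=\Gamma_i\subseteq\gamma'$, with normal $n_f$ ($=n_{ij}$, resp. $n_i$) and centroid $x_f$, the field moments and the face moments are $$c_f(u^h)=\operatorname*{argmin}_{b\in\mathbb R^{d(d+1)}}\ \tfrac12\sum_{i\notin\gamma}\kappa(|x_f-x_i|)\,\Big|\sum_s b_s\boldsymbol\phi_s(x_i)-u^h_i\Big|^2,\qquad (\mu_f)_s=\int_f\boldsymbol\phi_s\cdot n_f\,dS .$$ Unisolvency means that, for each such $f$, zero is the only element of $(P_1)^d$ that vanishes at all points $x_i$, $i\notin\gamma$, with $\kappa(|x_f-x_i|)>0$; the minimizer is then unique. Given a field $u$ on $\gamma$, the GMLS instance of the meshfree mimetic divergence (MMD)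 operator is $$(DIV\,u^h)_i=\frac1{\mu_i}\Big[\sum_{j}c_{ij}(u^h)\cdot\mu_{ij}+\big(c_{\Gamma_i}(u^h)\cdot\mu_{\Gamma_i}\text{ if }\Gamma_i\subseteq\gamma'\big)+\Big(\int_{\Gamma_i}u\cdot n_i\,dS\text{ if }\Gamma_i\subseteq\gamma\Big)\Big],$$ where $j$ runs over the neighbours of $i$, $c_{ij}=c_{f_{ij}}$ and $\mu_{ij}=\mu_{f_{ij}}$ (with the normal $n_{ij}$). **Theorem 4.1.** 1. (Local conservation.) If unisolvency holds, then for every $u^h$, every prescribed field $u$ on $\gamma$ and every set $S$ of indices, with $\omega=\bigcup_{i\in S}\omega_i$, $$\sum_{i\in S}\mu_i(DIV\,u^h)_i=\sum_{i\in S}\ \sum_{j:\,f_{ij}\subseteq\partial\omega}c_{ij}(u^h)\cdot\mu_{ij}+\sum_{k\in S,\ \Gamma_k\subseteq\gamma'}c_{\Gamma_k}(u^h)\cdot\mu_{\Gamma_k}+\sum_{k\in S,\ \Gamma_k\subseteq\gamma}\int_{\Gamma_k}u\cdot n_k\,dS ,$$ where $j$ runs over neighbours of $i$. 2. (Global conservation.)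 If $\gamma=\Gamma$ and unisolvency holds, then for every $u^h$ and every $u$ that is continuous on $\Gamma$, $\sum_i\mu_i(DIV\,u^h)_i=\int_\Gamma u\cdot n\,dS$, where $n$ is the outward unit normal of $\Omega$. 3. (First-order accuracy.) Let $h_X=\sup_{x\in\Omega}\min_i|x-x_i|$ and $q_X=\tfrac12\min_{i\ne j}|x_i-x_j|$. For all constants $c_{qu},c_{reg}$ there is $K_0>0$ such that for every $K_1\ge K_0$ there are $h_0>0$ and $C$, depending only on $\Omega,d,c_{qu},c_{reg},K_1$, with the following property. For every cloud and dual mesh as above with $q_X\le h_X\le c_{qu}q_X$, $h_X\le h_0$, and $\operatorname{diam}\omega_i\le c_{reg}h_X$, $h_X^d\le c_{reg}\mu_i$ for all $i$, for every $\gamma$ and every $\epsilon\in[K_0h_X,K_1h_X]$, unisolvency holds, and for every basis of $P_1$ and every $u\in C^2(\Omega)^d$ that has bounded derivatives of order at most two and is continuous on $\overline\Omega$, with point sample $u^h=(u(x_i))_{i\notin\gamma}$, $$\max_{1\le i\le N}\big|\nabla\cdot u(x_i)-(DIV\,u^h)_i\big|\le C\,h_X\,\|u\|_{C^2(\Omega)}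 .$$ At boundary points $\nabla\cdot u$ is formed with the derivative of $u$ relative to $\overline\Omega$. -/

import Mathlib

open MeasureTheory Set
open scoped RealInnerProductSpace

noncomputable section

namespace MMD

/-- The Euclidean space `ℝ^d`. -/
abbrev Vec (d : ℕ) := EuclideanSpace ℝ (Fin d)

/-! ### The domain -/

/-- A bounded connected open set with Lipschitz boundary: near every boundary point, and in
the direction of some unit vector `ν`, the set is the strict epigraph of a Lipschitz function of
the components orthogonal to `ν`. -/
structure IsLipschitzDomain {d : ℕ} (Ω : Set (Vec d)) : Prop where
  isOpen : IsOpen Ω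
  isConnected : IsConnected Ω
  isBounded : Bornology.IsBounded Ω
  lipschitz_boundary : ∀ x ∈ frontier Ω, ∃ ν : Vec d, ‖ν‖ = 1 ∧ ∃ r > 0,
    ∃ (L : NNReal) (ψ : Vec d → ℝ), LipschitzWith L ψ ∧
      ∀ y ∈ Metric.ball x r, y ∈ Ω ↔ ψ (y - ⟪ν, y⟫ • ν) < ⟪ν, y⟫

/-- `n` is the outer unit normal of the closed set `K` at `x`, where `K` coincides near `x` with
the half-space `{y | ⟪n, y - x⟫ ≤ 0}`. -/
def IsOuterNormalAt {d : ℕ} (K : Set (Vec d)) (x n : Vec d) : Prop :=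
  ‖n‖ = 1 ∧ ∃ r > 0, ∀ y ∈ Metric.ball x r, y ∈ K ↔ ⟪n, y - x⟫ ≤ 0

open Classical in
/-- The outer unit normal field of a closed set with piecewise flat boundary (zero at the points
where there is no outer unit normal in the sense of `IsOuterNormalAt`). -/
def outerNormal {d : ℕ} (K : Set (Vec d)) (x : Vec d) : Vec d :=
  if h : ∃ n, IsOuterNormalAt K x n then h.choose else 0

/-- The surface integral `∫_f u ⬝ n dS` for a constant vector `n`. The surface measure is the
`(d-1)`-dimensional Hausdorff measure, normalized to agree with Lebesgue measure on
hyperplanes. -/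
def flux {d : ℕ} (f : Set (Vec d)) (n : Vec d) (u : Vec d → Vec d) : ℝ :=
  ∫ x in f, ⟪u x, n⟫ ∂μHE[d - 1]

/-- The flux `∫_Γ u ⬝ n dS` through the whole boundary `Γ` of `Ω`. -/
def boundaryFlux {d : ℕ} (Ω : Set (Vec d)) (u : Vec d → Vec d) : ℝ :=
  ∫ x in frontier Ω, ⟪u x, outerNormal (closure Ω) x⟫ ∂μHE[d - 1]

/-- The centroid of a face `f`, with respect to surface measure. -/
def centroid {d : ℕ} (f : Set (Vec d)) : Vec d :=
  ((μHE[d - 1] : Measure (Vec d)) f).toReal⁻¹ • ∫ x in f, x ∂μHE[d - 1]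

/-! ### Fields of class `C²` -/

/-- `u` is of class `C²` on the open set `Ω`, with bounded derivatives of order at most two, and is
continuous up to the boundary. -/
structure IsC2 {d : ℕ} (Ω : Set (Vec d)) (u : Vec d → Vec d) : Prop where
  contDiffOn : ContDiffOn ℝ 2 u Ω
  continuousOn : ContinuousOn u (closure Ω)
  bddAbove : ∀ k ≤ 2, BddAbove ((fun x => ‖iteratedFDeriv ℝ k u x‖) '' Ω)

/-- The norm of `C²(Ω)`: the sum over `k ≤ 2` of the suprema over `Ω` of the `k`-th derivative. -/
def c2Norm {d : ℕ} (Ω : Set (Vec d)) (u : Vec d → Vec d) : ℝ :=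
  ∑ k ∈ Finset.range 3, sSup ((fun x => ‖iteratedFDeriv ℝ k u x‖) '' Ω)

/-- The divergence of `u` at a point of the closure of `Ω`. On the boundary the derivative is
the one relative to the closure of `Ω`. -/
def divergence {d : ℕ} (Ω : Set (Vec d)) (u : Vec d → Vec d) (x : Vec d) : ℝ :=
  ∑ k : Fin d, (fderivWithin ℝ u (closure Ω) x (EuclideanSpace.single k 1)) k

/-! ### Point clouds with a physical dual mesh -/

/-- A point cloud `x_0, …, x_{N-1}` on the domain `Ω`, together with a conforming dual mesh of
`Ω` with affine faces. Every point `x_i` has a dual cell `ω_i`. Two neighbouring cells share the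
face `f_ij = ∂ω_i ∩ ∂ω_j`, and the cell of a boundary point has the boundary segment
`Γ_i = ∂ω_i ∩ ∂Ω`. -/
structure DualMesh {d : ℕ} (Ω : Set (Vec d)) (N : ℕ) where
  /-- the points of the cloud -/
  pt : Fin N → Vec d
  /-- the dual cells -/
  cell : Fin N → Set (Vec d)
  /-- the indices of the boundary points -/
  bdry : Finset (Fin N)
  /-- the neighbours of a point -/
  nbr : Fin N → Finset (Fin N)
  /-- the unit normal of `f_ij` that points out of `ω_i` -/
  normal : Fin N → Fin N → Vec d
  /-- the outward unit normal of the boundary segment `Γ_i` -/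
  bdryNormal : Fin N → Vec d
  pt_injective : Function.Injective pt
  pt_mem_cell : ∀ i, pt i ∈ cell i
  pt_interior : ∀ i ∉ bdry, pt i ∈ Ω
  pt_bdry : ∀ i ∈ bdry, pt i ∈ frontier Ω
  cell_regular : ∀ i, closure (interior (cell i)) = cell i
  cell_disjoint : ∀ i j, i ≠ j → Disjoint (interior (cell i)) (interior (cell j))
  cell_cover : ⋃ i, cell i = closure Ω
  nbr_irrefl : ∀ i, i ∉ nbr i
  nbr_symm : ∀ i j, j ∈ nbr i → i ∈ nbr j
  /-- the boundary of `ω_i` consists of its faces `f_ij` and, for a boundary point, of `Γ_i` -/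
  frontier_cell : ∀ i, frontier (cell i) =
    (⋃ j ∈ nbr i, frontier (cell i) ∩ frontier (cell j)) ∪
      (if i ∈ bdry then frontier (cell i) ∩ frontier Ω else ∅)
  frontier_domain : frontier Ω = ⋃ i ∈ bdry, frontier (cell i) ∩ frontier Ω
  /-- every face `f_ij` lies in a hyperplane with normal `n_ij` -/
  face_affine : ∀ i, ∀ j ∈ nbr i, ∃ b : ℝ,
    ∀ x ∈ frontier (cell i) ∩ frontier (cell j), ⟪normal i j, x⟫ = b
  bdryFace_affine : ∀ i ∈ bdry, ∃ b : ℝ,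
    ∀ x ∈ frontier (cell i) ∩ frontier Ω, ⟪bdryNormal i, x⟫ = b
  face_pos : ∀ i, ∀ j ∈ nbr i,
    0 < (μHE[d - 1] : Measure (Vec d)) (frontier (cell i) ∩ frontier (cell j))
  bdryFace_pos : ∀ i ∈ bdry, 0 < (μHE[d - 1] : Measure (Vec d)) (frontier (cell i) ∩ frontier Ω)
  /-- `n_ij` is the outer unit normal of `ω_i` at almost every point of `f_ij` -/
  normal_outer : ∀ i, ∀ j ∈ nbr i,
    ∀ᵐ x ∂(μHE[d - 1] : Measure (Vec d)).restrict (frontier (cell i) ∩ frontier (cell j)),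
      IsOuterNormalAt (cell i) x (normal i j)
  bdryNormal_outer : ∀ i ∈ bdry,
    ∀ᵐ x ∂(μHE[d - 1] : Measure (Vec d)).restrict (frontier (cell i) ∩ frontier Ω),
      IsOuterNormalAt (cell i) x (bdryNormal i)

namespace DualMesh

variable {d N : ℕ} {Ω : Set (Vec d)} (M : DualMesh Ω N)

/-- The dual face `f_ij = ∂ω_i ∩ ∂ω_j`. -/
def face (i j : Fin N) : Set (Vec d) := frontier (M.cell i) ∩ frontier (M.cell j)

/-- The boundary segment `Γ_i = ∂ω_i ∩ ∂Ω`. -/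
def bdryFace (i : Fin N) : Set (Vec d) := frontier (M.cell i) ∩ frontier Ω

/-- The measure `μ_i` of the dual cell `ω_i`. -/
def vol (i : Fin N) : ℝ := (volume (M.cell i)).toReal

/-- The fill distance `sup_{x ∈ Ω} min_i |x - x_i|` of the point cloud. -/
def fillDist : ℝ := ⨆ x : Ω, ⨅ i, dist (x : Vec d) (M.pt i)

/-- The separation distance `(1/2) min_{i ≠ j} |x_i - x_j|` of the point cloud. -/
def sepDist : ℝ := (⨅ p : {p : Fin N × Fin N // p.1 ≠ p.2}, dist (M.pt p.1.1) (M.pt p.1.2)) / 2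

/-- The point cloud is quasi-uniform with constant `c`. -/
def QuasiUniform (c : ℝ) : Prop := M.sepDist ≤ M.fillDist ∧ M.fillDist ≤ c * M.sepDist

/-- The dual cells have diameter `O(h)` and volume at least of order `h^d`, where `h` is the fill
distance; `c` is the constant in both estimates. -/
def ShapeRegular (c : ℝ) : Prop :=
  ∀ i, Metric.diam (M.cell i) ≤ c * M.fillDist ∧ M.fillDist ^ d ≤ c * M.vol i

/-! ### Generalized moving least squares

`γ` is the set of the indices of the boundary segments that form the part of the boundary where the
field is prescribed. Fields are sampled at the points `x_i` with `i ∉ γ`. -/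

/-- Point samples at the points of the cloud outside of `γ`. -/
abbrev Samples (_M : DualMesh Ω N) (γ : Finset (Fin N)) := {i : Fin N // i ∉ γ} → Vec d

/-- The point sample of a vector field. -/
def sample (γ : Finset (Fin N)) (u : Vec d → Vec d) : M.Samples γ := fun i => u (M.pt i)

/-- The centroids of the faces `f_ij` and of the segments `Γ_i` outside of `γ`, i.e. the points where
the weights of the least squares problems are anchored. -/
def anchors (γ : Finset (Fin N)) : Set (Vec d) :=
  {z | (∃ i, ∃ j ∈ M.nbr i, z = centroid (M.face i j)) ∨
    ∃ i ∈ M.bdry \ γ, z = centroid (M.bdryFace i)}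

end DualMesh

/-- The kernel `κ(ρ) = (1 - ρ/ε)_+^4`. -/
def kernel (ε ρ : ℝ) : ℝ := (max (1 - ρ / ε) 0) ^ 4

/-- A basis of the space `P₁` of real polynomials on `ℝ^d` of degree at most one. -/
abbrev P1Basis (d : ℕ) := Module.Basis (Fin (d + 1)) ℝ (Vec d →ᵃ[ℝ] ℝ)

/-- The basis `e_k φ_r` of `(P₁)^d`, indexed by the pairs `s = (k, r)`. -/
def P1Basis.vec {d : ℕ} (φ : P1Basis d) (s : Fin d × Fin (d + 1)) (x : Vec d) : Vec d :=
  φ s.2 x • EuclideanSpace.single s.1 1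

namespace DualMesh

variable {d N : ℕ} {Ω : Set (Vec d)} (M : DualMesh Ω N)

/-- For every face, the sampling points of positive weight are unisolvent for `(P₁)^d`. -/
def Unisolvent (γ : Finset (Fin N)) (ε : ℝ) : Prop :=
  ∀ z ∈ M.anchors γ, ∀ p : Vec d →ᵃ[ℝ] Vec d,
    (∀ i, i ∉ γ → 0 < kernel ε (dist z (M.pt i)) → p (M.pt i) = 0) → p = 0

/-- The weighted least squares functional `(1/2) |B b - u^h|²_W` with weights anchored at `z`. -/
def lsq (γ : Finset (Fin N)) (ε : ℝ) (φ : P1Basis d) (z : Vec d) (uh : M.Samples γ)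
    (b : Fin d × Fin (d + 1) → ℝ) : ℝ :=
  (1 / 2) * ∑ i : {i : Fin N // i ∉ γ},
    kernel ε (dist z (M.pt i)) * ‖∑ s, b s • φ.vec s (M.pt i) - uh i‖ ^ 2

/-- The field moments: the vector of GMLS coefficients `argmin_b (1/2) |B b - u^h|²_W`. The
minimizer is unique if the sampling points of positive weight are unisolvent. -/
def gmls (γ : Finset (Fin N)) (ε : ℝ) (φ : P1Basis d) (z : Vec d) (uh : M.Samples γ) :
    Fin d × Fin (d + 1) → ℝ :=
  Classical.epsilon fun c => ∀ b, M.lsq γ ε φ z uh c ≤ M.lsq γ ε φ z uh b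

/-- The contraction of the field moments of a face `f` with unit normal `n` with its face moments
`∫_f φ_s ⬝ n dS`. -/
def gmlsFlux (γ : Finset (Fin N)) (ε : ℝ) (φ : P1Basis d) (f : Set (Vec d)) (n : Vec d)
    (uh : M.Samples γ) : ℝ :=
  ∑ s, M.gmls γ ε φ (centroid f) uh s * flux f n (φ.vec s)

/-- The GMLS instance of the meshfree mimetic divergence operator. It acts on the point samples
`uh` and on the field `g` that is prescribed on `γ`. -/
def DIV (γ : Finset (Fin N)) (ε : ℝ) (φ : P1Basis d) (uh : M.Samples γ) (g : Vec d → Vec d)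
    (i : Fin N) : ℝ :=
  1 / M.vol i *
    (∑ j ∈ M.nbr i, M.gmlsFlux γ ε φ (M.face i j) (M.normal i j) uh
      + (if i ∈ M.bdry \ γ then M.gmlsFlux γ ε φ (M.bdryFace i) (M.bdryNormal i) uh else 0)
      + (if i ∈ γ then flux (M.bdryFace i) (M.bdryNormal i) g else 0))

end DualMesh

end MMD

end

/-!
The two conservation laws rest on the cancellation of interior fluxes. At almost every point of the
face `f_ij` both cells coincide locally with half-spaces, and their interiors are disjoint, so
`n_ji = -n_ij` (`DualMesh.normal_symm`) and the flux contributions of a neighbouring pair cancel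
(`sum_filter_antisymm_eq_zero`). A face between a cell of `S` and a cell outside of `S` lies on the
boundary of the union of the cells of `S` (`DualMesh.face_subset_frontier_biUnion`). For global
conservation the segments `Γ_i` overlap in null sets, and their normals are almost everywhere outer
normals of `Ω` (`DualMesh.ae_outerNormal_closure`), because a Lipschitz domain does not lie on both
sides of its boundary.

First-order accuracy combines three ingredients.

* The divergence theorem for affine fields `T` on a dual cell (`divergence_flat_faces`): the surface
  fluxes of `T` add up to `μ_i div T`. It is proved coordinate by coordinate. On almost every line in
  direction `e_k` the cell is a finite union of intervals that end at regular points of the faces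
  (`sum_sign_of_finite_frontier`), and the area formula for graphs over coordinate hyperplanes
  (`setIntegral_flat`) converts the integral over the lines into surface integrals with weight `n_k`.
* Taylor approximation up to the boundary. A Lipschitz domain has the uniform cone property
  (`IsLipschitzDomain.exists_uniformCone`), and all that is needed of the domain follows from it.
  Nearby points of the closure are joined by paths of comparable length in `Ω`, so a field of
  class `C²` is approximated to second order by an affine field `T`, at distances `O(h)` from `x_i`,
  whose divergence is `O(h)`-close to that of `u` at `x_i` (`IsC2.exists_affine_approx`).
* Stability of the least squares problems. The cone property provides interior points of the
  cloud near the vertices of a simplex of size `O(h)`, which control affine fields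
  (`DualMesh.exists_affine_bound`); this gives unisolvency for every `γ`. Minimality
  and a packing bound for the number of points in the support of the kernel show that the
  reconstruction differs from `T` by `O(h²)` on the cell (`DualMesh.norm_gmls_field_sub_le`).

Thus every face contributes a flux error of at most `O(h²)` times its area. A face lies in a
hyperplane and in a ball of radius `O(h)`, so its area is `O(h^{d-1})`, and the number of faces of a
cell is bounded by packing. Division by `μ_i ≥ h^d / c` leaves an error `O(h)`.
-/

noncomputable section

namespace MMD

/-! ### A one-dimensional fundamental theorem on finite unions of intervals -/

open Filter Topology in
/-- Let `A` be a compact set of reals whose boundary points are among finitely many points `e a`,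
and suppose that near `e a` the set `A` is the half-line to the left (`0 < n a`) or to the right
(`n a < 0`) of `e a`. The signs of the `n a` sum to zero, and the signed sum of the `e a` is the
length of `A`. -/
theorem sum_sign_of_finite_frontier {ι : Type*} (E : Finset ι) (e n : ι → ℝ) {A : Set ℝ}
    (hA : IsCompact A) (hinj : Set.InjOn e E) (hn : ∀ a ∈ E, n a ≠ 0)
    (hfr : ∀ t ∈ frontier A, ∃ a ∈ E, t = e a)
    (hloc : ∀ a ∈ E, ∀ᶠ t in 𝓝 (e a), t ∈ A ↔ n a * (t - e a) ≤ 0) :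
    ∑ a ∈ E, (SignType.sign (n a) : ℝ) = 0 ∧
      (volume A).toReal = ∑ a ∈ E, (SignType.sign (n a) : ℝ) * e a := by
  classical
  -- the jump of the indicator of `A` at `e a`
  set s : ι → ℝ → ℝ := fun a t =>
    if 0 < n a then (Iic (e a)).indicator 1 t else -(Iio (e a)).indicator 1 t with hs
  have s_const : ∀ a t, t ≠ e a → ∀ᶠ y in 𝓝 t, s a y = s a t := by
    intro a t hne
    rcases lt_or_gt_of_ne hne with h | h
    · filter_upwards [Iio_mem_nhds h] with y hy
      simp only [hs, indicator, mem_Iic, mem_Iio, Pi.one_apply] at *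
      simp [h, h.le, hy, le_of_lt hy]
    · filter_upwards [Ioi_mem_nhds h] with y hy
      simp only [hs, indicator, mem_Iic, mem_Iio, mem_Ioi, Pi.one_apply] at *
      simp [not_lt.2 h.le, not_le.2 h, not_le.2 hy, not_lt.2 (le_of_lt hy)]
  set f : ℝ → ℝ := fun t => A.indicator 1 t - ∑ a ∈ E, s a t with hf
  have hlc : IsLocallyConstant f := by
    rw [IsLocallyConstant.iff_eventually_eq]
    intro t
    by_cases ht : ∃ a ∈ E, t = e a
    · obtain ⟨a, ha, rfl⟩ := ht
      have h1 : ∀ᶠ y in 𝓝 (e a), ∀ b ∈ E.erase a, s b y = s b (e a) := by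
        rw [Filter.eventually_all_finset]
        intro b hb
        refine s_const b _ fun h => (Finset.mem_erase.1 hb).1 ?_
        exact (hinj ha (Finset.mem_erase.1 hb).2 h).symm
      have key : ∀ y, (y ∈ A ↔ n a * (y - e a) ≤ 0) →
          A.indicator 1 y - s a y = if 0 < n a then (0 : ℝ) else 1 := by
        intro y hy
        rcases lt_or_gt_of_ne (hn a ha) with h | h
        · have : (y ∈ A) ↔ ¬ y < e a := by
            rw [hy, not_lt]
            constructor
            · intro h'; nlinarith
            · intro h'; nlinarith
          simp only [hs, indicator, mem_Iio, Pi.one_apply, this, not_lt.2 h.le, if_false]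
          split_ifs <;> simp_all
        · have : (y ∈ A) ↔ y ≤ e a := by
            rw [hy]
            constructor
            · intro h'; nlinarith
            · intro h'; nlinarith
          simp only [hs, indicator, mem_Iic, Pi.one_apply, this, h, if_true]
          split_ifs <;> simp_all
      filter_upwards [h1, hloc a ha] with y hy1 hy2
      have h3 := key y hy2
      have h4 := key (e a) (hloc a ha).self_of_nhds
      simp only [hf]
      rw [← Finset.add_sum_erase _ _ ha, ← Finset.add_sum_erase (a := a) (s := E) _ ha,
        Finset.sum_congr rfl hy1]
      linarith
    · have h1 : ∀ᶠ y in 𝓝 t, ∀ b ∈ E, s b y = s b t := by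
        rw [Filter.eventually_all_finset]
        intro b hb
        exact s_const b _ fun h => ht ⟨b, hb, h⟩
      have h2 : ∀ᶠ y in 𝓝 t, (y ∈ A ↔ t ∈ A) := by
        have hnf : t ∉ frontier A := fun h => ht (hfr t h)
        by_cases htA : t ∈ A
        · have : t ∈ interior A := by
            by_contra h
            exact hnf ⟨subset_closure htA, h⟩
          filter_upwards [mem_interior_iff_mem_nhds.1 this] with y hy
          simp [hy, htA]
        · filter_upwards [hA.isClosed.isOpen_compl.mem_nhds htA] with y hy
          simp only [htA, iff_false]
          exact hy
      filter_upwards [h1, h2] with y hy1 hy2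
      simp only [hf]
      rw [Finset.sum_congr rfl hy1]
      simp [indicator, hy2]
  obtain ⟨R, hR⟩ : ∃ R : ℝ, A ⊆ Icc (-R) R ∧ ∀ a ∈ E, e a ∈ Ioo (-R) R := by
    obtain ⟨R1, hR1⟩ := hA.isBounded.subset_closedBall 0
    obtain ⟨R2, hR2⟩ := (E.finite_toSet.image e).isBounded.subset_closedBall 0
    refine ⟨max R1 R2 + 1, fun t ht => ?_, fun a ha => ?_⟩
    · have := hR1 ht
      rw [mem_closedBall_zero_iff, Real.norm_eq_abs, abs_le] at this
      have := le_max_left R1 R2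
      constructor <;> linarith
    · have := hR2 ⟨a, ha, rfl⟩
      rw [mem_closedBall_zero_iff, Real.norm_eq_abs, abs_le] at this
      have := le_max_right R1 R2
      constructor <;> linarith
  have hzero : ∀ t, f t = 0 := by
    intro t
    rw [hlc.apply_eq_of_preconnectedSpace t (R + 1)]
    have h1 : R + 1 ∉ A := fun h => by have := (hR.1 h).2; linarith
    have h2 : ∀ a ∈ E, s a (R + 1) = 0 := by
      intro a ha
      have := (hR.2 a ha).2
      simp only [hs, indicator, mem_Iic, mem_Iio, Pi.one_apply]
      rw [if_neg (not_le.2 (by linarith : e a < R + 1)),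
        if_neg (not_lt.2 (by linarith : e a ≤ R + 1))]
      simp
    simp [hf, h1, Finset.sum_eq_zero h2]
  have hsum0 : ∑ a ∈ E, (SignType.sign (n a) : ℝ) = 0 := by
    have h := hzero (-R - 1)
    have h1 : -R - 1 ∉ A := fun h => by have := (hR.1 h).1; linarith
    have h2 : ∀ a ∈ E, s a (-R - 1) = (SignType.sign (n a) : ℝ) := by
      intro a ha
      have := (hR.2 a ha).1
      simp only [hs, indicator, mem_Iic, mem_Iio, Pi.one_apply]
      rw [if_pos (by linarith : -R - 1 ≤ e a), if_pos (by linarith : -R - 1 < e a)]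
      rcases lt_or_gt_of_ne (hn a ha) with h | h
      · simp [h, not_lt.2 h.le]
      · simp [h]
    simp only [hf, h1, not_false_eq_true, indicator_of_notMem, zero_sub, neg_eq_zero] at h
    rw [← h]
    exact (Finset.sum_congr rfl h2).symm
  refine ⟨hsum0, ?_⟩
  have hs_int : ∀ a ∈ E, IntegrableOn (s a) (Ioc (-R - 1) R) ∧
      ∫ t in Ioc (-R - 1) R, s a t = (SignType.sign (n a) : ℝ) * (e a + R + 1) := by
    intro a ha
    have h1 := (hR.2 a ha).1
    have h2 := (hR.2 a ha).2
    rcases lt_or_gt_of_ne (hn a ha) with h | h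
    · have : s a = fun t => -(Iio (e a)).indicator 1 t := by
        funext t; simp [hs, not_lt.2 h.le]
      rw [this]
      constructor
      · refine Integrable.neg (IntegrableOn.integrable ?_)
        exact (integrable_indicator_iff measurableSet_Iio).2 (by
          rw [IntegrableOn, Measure.restrict_restrict measurableSet_Iio]
          exact integrableOn_const (by
            refine ((measure_mono inter_subset_right).trans_lt ?_).ne
            simp))
      · rw [integral_neg, integral_indicator_one measurableSet_Iio, measureReal_restrict_apply
          measurableSet_Iio]
        have : Iio (e a) ∩ Ioc (-R - 1) R = Ioo (-R - 1) (e a) := by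
          ext t; simp only [mem_inter_iff, mem_Iio, mem_Ioc, mem_Ioo]
          constructor
          · rintro ⟨h3, h4, h5⟩; exact ⟨h4, h3⟩
          · rintro ⟨h3, h4⟩; exact ⟨h4, h3, by linarith⟩
        rw [this, Real.volume_real_Ioo_of_le (by linarith)]
        simp [h]; ring
    · have : s a = fun t => (Iic (e a)).indicator 1 t := by
        funext t; simp [hs, h]
      rw [this]
      constructor
      · refine IntegrableOn.integrable ?_
        exact (integrable_indicator_iff measurableSet_Iic).2 (by
          rw [IntegrableOn, Measure.restrict_restrict measurableSet_Iic]
          exact integrableOn_const (by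
            refine ((measure_mono inter_subset_right).trans_lt ?_).ne
            simp))
      · rw [integral_indicator_one measurableSet_Iic, measureReal_restrict_apply
          measurableSet_Iic]
        have : Iic (e a) ∩ Ioc (-R - 1) R = Ioc (-R - 1) (e a) := by
          ext t; simp only [mem_inter_iff, mem_Iic, mem_Ioc]
          constructor
          · rintro ⟨h3, h4, h5⟩; exact ⟨h4, h3⟩
          · rintro ⟨h3, h4⟩; exact ⟨h4, h3, by linarith⟩
        rw [this, Real.volume_real_Ioc_of_le (by linarith)]
        simp [h]; ring
  have hvol : ∫ t in Ioc (-R - 1) R, A.indicator 1 t = (volume A).toReal := by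
    rw [integral_indicator_one hA.measurableSet, measureReal_restrict_apply hA.measurableSet,
      inter_eq_left.2]
    · rfl
    · intro t ht
      have := hR.1 ht
      exact ⟨by linarith [this.1], this.2⟩
  rw [← hvol]
  have : ∀ t, A.indicator 1 t = ∑ a ∈ E, s a t := fun t => by
    have := hzero t; simp only [hf] at this; linarith
  simp only [this]
  rw [integral_finsetSum _ fun a ha => (hs_int a ha).1, Finset.sum_congr rfl fun a ha =>
    (hs_int a ha).2]
  have : ∀ a ∈ E, (SignType.sign (n a) : ℝ) * (e a + R + 1) =
    (SignType.sign (n a) : ℝ) * e a + (SignType.sign (n a) : ℝ) * (R + 1) := fun a _ => by ring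
  rw [Finset.sum_congr rfl this, Finset.sum_add_distrib, ← Finset.sum_mul, hsum0]
  ring

/-! ### Coordinate lines and graphs over coordinate hyperplanes -/

/-- The point with `k`-th coordinate `t` whose other coordinates are those of `y`. -/
def ins {m : ℕ} (k : Fin (m + 1)) (t : ℝ) (y : Vec m) : Vec (m + 1) :=
  WithLp.toLp 2 (k.insertNth t (WithLp.ofLp y) : Fin (m + 1) → ℝ)

/-- The projection of `ℝ^{m+1}` to `ℝ^m` that forgets the `k`-th coordinate. -/
def drop {m : ℕ} (k : Fin (m + 1)) (x : Vec (m + 1)) : Vec m :=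
  WithLp.toLp 2 fun l => x (k.succAbove l)

section
variable {m : ℕ} (k : Fin (m + 1))

@[simp] theorem ins_same (t : ℝ) (y : Vec m) : ins k t y k = t := by simp [ins]

@[simp] theorem ins_succAbove (t : ℝ) (y : Vec m) (l : Fin m) :
    ins k t y (k.succAbove l) = y l := by simp [ins]

@[simp] theorem drop_apply (x : Vec (m + 1)) (l : Fin m) : drop k x l = x (k.succAbove l) := rfl

theorem vec_ext_succAbove {x y : Vec (m + 1)} (h : x k = y k)
    (h' : ∀ l, x (k.succAbove l) = y (k.succAbove l)) : x = y := by
  ext j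
  rcases Fin.eq_self_or_eq_succAbove k j with rfl | ⟨l, rfl⟩
  · exact h
  · exact h' l

@[simp] theorem ins_drop (x : Vec (m + 1)) : ins k (x k) (drop k x) = x :=
  vec_ext_succAbove k (by simp) (by simp)

@[simp] theorem drop_ins (t : ℝ) (y : Vec m) : drop k (ins k t y) = y := by
  ext l; simp

theorem ins_sub_ins (t s : ℝ) (y : Vec m) :
    ins k t y - ins k s y = (t - s) • EuclideanSpace.single k (1 : ℝ) :=
  vec_ext_succAbove k (by simp) (by simp)

theorem continuous_ins : Continuous fun p : ℝ × Vec m => ins k p.1 p.2 := by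
  unfold ins
  apply (PiLp.continuous_toLp 2 _).comp
  refine continuous_pi fun j => ?_
  rcases Fin.eq_self_or_eq_succAbove k j with rfl | ⟨l, rfl⟩
  · simpa using continuous_fst
  · simp only [Fin.insertNth_apply_succAbove]; fun_prop

theorem continuous_drop : Continuous (drop k) := by
  unfold drop
  apply (PiLp.continuous_toLp 2 _).comp
  fun_prop

theorem dist_drop_le (x y : Vec (m + 1)) : dist (drop k x) (drop k y) ≤ dist x y := by
  rw [EuclideanSpace.dist_eq, EuclideanSpace.dist_eq]
  refine Real.sqrt_le_sqrt ?_
  rw [Fin.sum_univ_succAbove _ k]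
  simp only [drop_apply]
  have := sq_nonneg (dist (x k) (y k))
  linarith

theorem inner_eq_succAbove (x y : Vec (m + 1)) :
    ⟪x, y⟫ = x k * y k + ∑ l, x (k.succAbove l) * y (k.succAbove l) := by
  rw [PiLp.inner_apply, Fin.sum_univ_succAbove _ k]
  simp [mul_comm]

theorem inner_single_one (x : Vec (m + 1)) : ⟪x, EuclideanSpace.single k (1 : ℝ)⟫ = x k := by
  simp [EuclideanSpace.inner_single_right]

/-- Projections along a coordinate axis map null sets for surface measure to Lebesgue null sets. -/
theorem volume_drop_image_eq_zero {s : Set (Vec (m + 1))}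
    (hs : (μHE[m] : Measure (Vec (m + 1))) s = 0) : volume (drop k '' s) = 0 := by
  rw [← EuclideanSpace.euclideanHausdorffMeasure_eq_volume]
  have hL : LipschitzWith 1 (drop k) := LipschitzWith.of_dist_le_mul fun x y => by
    simpa using dist_drop_le k x y
  rw [Measure.euclideanHausdorffMeasure_def, Measure.smul_apply] at hs ⊢
  have h1 := hL.hausdorffMeasure_image_le (d := m) (by positivity) s
  rw [Measure.nnreal_smul_coe_apply, mul_eq_zero] at hs ⊢
  rcases hs with hs | hs
  · exact Or.inl hs
  · exact Or.inr (by simpa [hs] using h1)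

/-- Fubini's theorem along the `k`-th coordinate. -/
theorem volume_eq_integral_slice {K : Set (Vec (m + 1))} (hK : IsCompact K) :
    Integrable (fun y : Vec m => (volume {t | ins k t y ∈ K}).toReal) ∧
    (volume K).toReal = ∫ y : Vec m, (volume {t | ins k t y ∈ K}).toReal := by
  have e1 := PiLp.volume_preserving_ofLp (Fin (m + 1))
  have e2 := volume_preserving_piFinSuccAbove (fun _ : Fin (m + 1) => ℝ) k
  have e3 := (MeasurePreserving.id (volume : Measure ℝ)).prod
    (PiLp.volume_preserving_toLp (Fin m))
  have e := (e3.comp e2).comp e1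
  set T : Set (ℝ × Vec m) := {p | ins k p.1 p.2 ∈ K} with hT
  have hTc : IsClosed T := hK.isClosed.preimage (continuous_ins k)
  have hvol : volume K = volume T := by
    rw [Measure.volume_eq_prod, ← e.measure_preimage hTc.measurableSet.nullMeasurableSet]
    congr 1
    ext x
    simp only [hT, mem_preimage, Function.comp_apply, mem_ofPred_eq]
    exact iff_of_eq (congrArg (· ∈ K) (ins_drop k x).symm)
  have hfin : volume T ≠ ⊤ := hvol ▸ hK.measure_ne_top
  rw [Measure.volume_eq_prod] at hfin
  have h1 := measurable_measure_prodMk_right (μ := (volume : Measure ℝ)) hTc.measurableSet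
  have h2 := Measure.prod_apply_symm (μ := (volume : Measure ℝ)) (ν := (volume : Measure (Vec m)))
    hTc.measurableSet
  rw [h2] at hfin
  refine ⟨integrable_toReal_of_lintegral_ne_top h1.aemeasurable hfin, ?_⟩
  rw [hvol, Measure.volume_eq_prod, h2]
  exact (integral_toReal h1.aemeasurable (ae_lt_top h1 hfin)).symm

/-- The point over `y` of the hyperplane `⟪n, x⟫ = b`, as a graph over the coordinate hyperplane
orthogonal to the `k`-th axis; meaningful if `n k ≠ 0`. -/
def graph (n : Vec (m + 1)) (b : ℝ) (y : Vec m) : Vec (m + 1) :=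
  ins k ((b - ∑ l, n (k.succAbove l) * y l) / n k) y

theorem eq_graph_drop {n : Vec (m + 1)} (hn : n k ≠ 0) {b : ℝ} {x : Vec (m + 1)}
    (hx : ⟪n, x⟫ = b) : x = graph k n b (drop k x) := by
  rw [inner_eq_succAbove k] at hx
  refine vec_ext_succAbove k ?_ (by simp [graph])
  simp only [graph, ins_same, drop_apply]
  field_simp
  linarith

theorem continuous_graph (n : Vec (m + 1)) (b : ℝ) : Continuous (graph k n b) := by
  unfold graph
  exact (continuous_ins k).comp
    (f := fun y : Vec m => ((b - ∑ l, n (k.succAbove l) * y l) / n k, y)) (by fun_prop)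

@[simp] theorem drop_graph (n : Vec (m + 1)) (b : ℝ) (y : Vec m) : drop k (graph k n b y) = y := by
  simp [graph]

/-- The linear part of `graph`. -/
def graphLin (n : Vec (m + 1)) : Vec m →ₗ[ℝ] Vec (m + 1) where
  toFun y := graph k n 0 y
  map_add' x y := by
    refine vec_ext_succAbove k ?_ (by simp [graph])
    simp only [graph, ins_same, PiLp.add_apply, mul_add, Finset.sum_add_distrib]
    ring
  map_smul' c x := by
    refine vec_ext_succAbove k ?_ (by simp [graph])
    simp only [graph, ins_same, PiLp.smul_apply, smul_eq_mul, RingHom.id_apply]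
    rw [← mul_div_assoc, mul_sub, Finset.mul_sum]
    congr 2
    · ring
    · exact Finset.sum_congr rfl fun l _ => by ring

theorem graph_eq_graphLin_add {n : Vec (m + 1)} (b : ℝ) (y : Vec m) :
    graph k n b y = graphLin k n y + (b / n k) • EuclideanSpace.single k (1 : ℝ) := by
  refine vec_ext_succAbove k ?_ (by simp [graph, graphLin])
  simp [graph, graphLin]
  ring

/-- The Jacobian of the graph map. The Gram matrix is a rank-one perturbation of the identity. -/
theorem normDet_graphLin {n : Vec (m + 1)} (hn : n k ≠ 0) (h1 : ‖n‖ = 1) :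
    (graphLin k n).normDet = |n k|⁻¹ := by
  have hsq := (graphLin k n).normDet_sq_eq_det_gram (EuclideanSpace.basisFun (Fin m) ℝ)
  have hgram : Matrix.gram ℝ (fun l => graphLin k n (EuclideanSpace.basisFun (Fin m) ℝ l)) =
      1 + Matrix.replicateCol Unit (fun l => n (k.succAbove l) / n k) *
        Matrix.replicateRow Unit (fun l => n (k.succAbove l) / n k) := by
    ext i j
    rw [Matrix.gram_apply, inner_eq_succAbove k]
    simp [graphLin, graph, Matrix.one_apply, Matrix.mul_apply]
    simp only [eq_comm (a := j)]
    ring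
  rw [hgram, Matrix.det_one_add_replicateCol_mul_replicateRow] at hsq
  have h2 : ⟪n, n⟫ = 1 := by rw [real_inner_self_eq_norm_sq, h1]; norm_num
  rw [inner_eq_succAbove k] at h2
  have h3 : (graphLin k n).normDet ^ 2 = (|n k|⁻¹) ^ 2 := by
    rw [inv_pow, sq_abs]
    simp only [RCLike.ofReal_real_eq_id, id] at hsq
    have h4 : ∑ l, n (k.succAbove l) / n k * (n (k.succAbove l) / n k) =
        (∑ l, n (k.succAbove l) * n (k.succAbove l)) / n k ^ 2 := by
      rw [Finset.sum_div]
      exact Finset.sum_congr rfl fun l _ => by field_simp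
    rw [hsq, dotProduct, h4, eq_sub_of_add_eq' h2]
    field_simp
    ring
  exact (pow_left_inj₀ (LinearMap.normDet_nonneg _) (by positivity) two_ne_zero).1 h3

theorem euclideanHausdorffMeasure_graph_image {n : Vec (m + 1)} (hn : n k ≠ 0) (h1 : ‖n‖ = 1)
    (b : ℝ) (s : Set (Vec m)) :
    (μHE[m] : Measure (Vec (m + 1))) (graph k n b '' s) = ENNReal.ofReal |n k|⁻¹ * volume s := by
  have h := (graphLin k n).euclideanHausdorffMeasure_image_eq_normDet_mul_volume s
  rw [normDet_graphLin k hn h1, finrank_euclideanSpace_fin] at h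
  rw [← h]
  have : graph k n b '' s =
      (fun x => (b / n k) • EuclideanSpace.single k (1 : ℝ) + x) '' (graphLin k n '' s) := by
    rw [image_image]
    refine image_congr fun y _ => ?_
    exact (graph_eq_graphLin_add k b y).trans (add_comm _ _)
  rw [this]
  exact (IsometryEquiv.addLeft _).isometry.euclideanHausdorffMeasure_image _

theorem measurableEmbedding_graph (n : Vec (m + 1)) (b : ℝ) :
    MeasurableEmbedding (graph k n b) := by
  refine (Topology.IsClosedEmbedding.measurableEmbedding ?_)
  exact (Function.LeftInverse.isClosedEmbedding (f := drop k) (fun y => drop_graph k n b y)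
    (continuous_drop k) (continuous_graph k n b))

theorem image_graph_drop {n : Vec (m + 1)} (hn : n k ≠ 0) {b : ℝ} {F : Set (Vec (m + 1))}
    (hF : ∀ x ∈ F, ⟪n, x⟫ = b) : graph k n b '' (drop k '' F) = F := by
  rw [image_image]
  conv_rhs => rw [← image_id F]
  exact image_congr fun x hx => (eq_graph_drop k hn (hF x hx)).symm

/-- Surface integrals over flat sets as integrals over their coordinate projections. -/
theorem setIntegral_flat {n : Vec (m + 1)} (hn : n k ≠ 0) (h1 : ‖n‖ = 1) {b : ℝ}
    {F : Set (Vec (m + 1))} (hF : ∀ x ∈ F, ⟪n, x⟫ = b) (g : Vec (m + 1) → ℝ) :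
    |n k| * ∫ x in F, g x ∂μHE[m] = ∫ y in drop k '' F, g (graph k n b y) := by
  have hme := measurableEmbedding_graph k n b
  have hcomap : Measure.comap (graph k n b) (μHE[m] : Measure (Vec (m + 1))) =
      ENNReal.ofReal |n k|⁻¹ • volume := by
    ext s hs
    rw [hme.comap_apply, euclideanHausdorffMeasure_graph_image k hn h1]
    rfl
  have hsub : F ⊆ range (graph k n b) := by
    rw [← image_graph_drop k hn hF]; exact image_subset_range _ _
  have hrestr : (μHE[m] : Measure (Vec (m + 1))).restrict F =
      (Measure.map (graph k n b) (ENNReal.ofReal |n k|⁻¹ • volume)).restrict F := by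
    rw [← hcomap, hme.map_comap, Measure.restrict_restrict_of_subset hsub]
  have hpre : graph k n b ⁻¹' F = drop k '' F := by
    conv_lhs => rw [← image_graph_drop k hn hF]
    exact preimage_image_eq _ hme.injective
  rw [hrestr, hme.setIntegral_map, hpre, Measure.restrict_smul, integral_smul_measure,
    ENNReal.toReal_ofReal (by positivity), smul_eq_mul, mul_inv_cancel_left₀ (abs_ne_zero.2 hn)]

end

/-- A flat set of diameter `O(ρ)` has surface measure `O(ρ^m)`. -/
theorem euclideanHausdorffMeasure_flat_le {m : ℕ} {n : Vec (m + 1)} (h1 : ‖n‖ = 1) {b : ℝ}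
    {F : Set (Vec (m + 1))} (hF : ∀ x ∈ F, ⟪n, x⟫ = b) {x₀ : Vec (m + 1)} {ρ : ℝ} (hρ : 0 ≤ ρ)
    (hball : F ⊆ Metric.closedBall x₀ ρ) :
    (μHE[m] : Measure (Vec (m + 1))) F ≤
      ENNReal.ofReal (Real.sqrt (m + 1) * ρ ^ m *
        (volume (Metric.ball (0 : Vec m) 1)).toReal) := by
  -- some coordinate of the unit vector `n` is not smaller than `1 / √(m + 1)`
  obtain ⟨k, hk⟩ : ∃ k, 1 / Real.sqrt (m + 1) ≤ |n k| := by
    by_contra! hcon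
    have h2 : ∑ k, |n k| ^ 2 < ∑ k : Fin (m + 1), (1 / Real.sqrt (m + 1)) ^ 2 :=
      Finset.sum_lt_sum_of_nonempty Finset.univ_nonempty fun k _ =>
        pow_lt_pow_left₀ (hcon k) (abs_nonneg _) two_ne_zero
    have h3 := EuclideanSpace.norm_sq_eq n
    simp only [Real.norm_eq_abs] at h3
    rw [← h3, h1] at h2
    simp only [one_div, inv_pow, Finset.sum_const, Finset.card_univ, Fintype.card_fin,
      nsmul_eq_mul] at h2
    rw [Real.sq_sqrt (by positivity)] at h2
    push_cast at h2
    rw [mul_inv_cancel₀ (by positivity)] at h2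
    norm_num at h2
  have hpos : 0 < |n k| := lt_of_lt_of_le (by positivity) hk
  have hn : n k ≠ 0 := abs_pos.1 hpos
  rw [← image_graph_drop k hn hF, euclideanHausdorffMeasure_graph_image k hn h1]
  have hsub : drop k '' F ⊆ Metric.closedBall (drop k x₀) ρ := by
    rintro _ ⟨x, hx, rfl⟩
    exact (dist_drop_le k _ _).trans (hball hx)
  refine (mul_le_mul_right (measure_mono hsub) _).trans ?_
  rw [Measure.addHaar_closedBall _ _ hρ, finrank_euclideanSpace_fin,
    ← ENNReal.ofReal_toReal (a := volume (Metric.ball (0 : Vec m) 1)) measure_ball_lt_top.ne,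
    ← ENNReal.ofReal_mul (by positivity), ← ENNReal.ofReal_mul (by positivity)]
  refine ENNReal.ofReal_le_ofReal ?_
  rw [ENNReal.toReal_ofReal (by positivity), ← mul_assoc]
  gcongr
  rw [inv_le_comm₀ hpos (by positivity)]
  simpa using hk

/-! ### The divergence theorem for affine fields on bodies with flat faces -/

open Filter Topology in
/-- Gauss' theorem `∫_{∂K} g n_k dS = ∫_K ∂_k g dx` for affine `g`. On almost every line parallel to
the `k`-th axis the faces that it meets are crossed transversally at regular points, where the
one-dimensional statement applies; integrating over the lines and changing variables on each face
gives the result. -/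
theorem divergence_flat_faces_coord {m : ℕ} {ι : Type*} (A : Finset ι) {K : Set (Vec (m + 1))}
    (hK : IsCompact K) (F : ι → Set (Vec (m + 1))) (n : ι → Vec (m + 1)) (b : ι → ℝ)
    (hF : ∀ a ∈ A, IsCompact (F a)) (hn : ∀ a ∈ A, ‖n a‖ = 1)
    (hflat : ∀ a ∈ A, ∀ x ∈ F a, ⟪n a, x⟫ = b a)
    (hfr : ∀ x ∈ frontier K, ∃ a ∈ A, x ∈ F a)
    (hout : ∀ a ∈ A, ∀ᵐ x ∂(μHE[m] : Measure (Vec (m + 1))).restrict (F a),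
      IsOuterNormalAt K x (n a))
    (hdisj : ∀ a ∈ A, ∀ a' ∈ A, a ≠ a' → (μHE[m] : Measure (Vec (m + 1))) (F a ∩ F a') = 0)
    (g : Vec (m + 1) →ᵃ[ℝ] ℝ) (k : Fin (m + 1)) :
    ∑ a ∈ A, n a k * ∫ x in F a, g x ∂μHE[m] =
      g.linear (EuclideanSpace.single k 1) * (volume K).toReal := by
  classical
  have hgc : Continuous g := AffineMap.continuous_of_finiteDimensional g
  -- almost every line in direction `e_k` meets the faces transversally and at regular points
  have hgood : ∀ᵐ y : Vec m, ∀ a ∈ A, ∀ x ∈ F a, drop k x = y →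
      n a k ≠ 0 ∧ IsOuterNormalAt K x (n a) ∧ ∀ a' ∈ A, a ≠ a' → x ∉ F a' := by
    rw [Filter.eventually_all_finset]
    intro a ha
    by_cases hk : n a k = 0
    -- a face parallel to `e_k` projects into a hyperplane
    · obtain ⟨l, hl⟩ : ∃ l, n a (k.succAbove l) ≠ 0 := by
        by_contra! hcon
        have h2 : ⟪n a, n a⟫ = 1 := by rw [real_inner_self_eq_norm_sq, hn a ha]; norm_num
        rw [inner_eq_succAbove k] at h2
        simp [hk, hcon] at h2
      let f : Vec m →ᵃ[ℝ] ℝ :=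
        (innerₗ (Vec m) (drop k (n a))).toAffineMap - AffineMap.const ℝ (Vec m) (b a)
      have hf : ∀ y, f y = ∑ l, n a (k.succAbove l) * y l - b a := by
        intro y
        simp [f, PiLp.inner_apply, mul_comm]
      have hnull : volume ((AffineSubspace.comap f (AffineSubspace.mk' (0 : ℝ) ⊥) :
          AffineSubspace ℝ (Vec m)) : Set (Vec m)) = 0 := by
        refine Measure.addHaar_affineSubspace _ _ fun htop => ?_
        have h3 : ∀ y, f y = 0 := by
          intro y
          have : y ∈ (AffineSubspace.comap f (AffineSubspace.mk' (0 : ℝ) ⊥)) := by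
            rw [htop]; trivial
          simpa [AffineSubspace.mem_mk'] using this
        have h4 := h3 (EuclideanSpace.single l 1)
        have h5 := h3 0
        simp [hf] at h4 h5
        simp [h5] at h4
        exact hl h4
      refine measure_mono_null (fun y hy => ?_) hnull
      simp only [mem_compl_iff, mem_ofPred_eq, not_forall] at hy
      obtain ⟨x, hx, rfl, -⟩ := hy
      have := hflat a ha x hx
      rw [inner_eq_succAbove k, hk] at this
      simp [AffineSubspace.mem_mk', hf]
      linarith
    · have hnull : (μHE[m] : Measure (Vec (m + 1))) ({x | ¬ (x ∈ F a → IsOuterNormalAt K x (n a))} ∪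
          ⋃ a' ∈ A.erase a, F a ∩ F a') = 0 := by
        rw [measure_union_null_iff]
        refine ⟨(ae_restrict_iff' (hF a ha).measurableSet).1 (hout a ha), ?_⟩
        refine (measure_biUnion_null_iff (A.erase a).countable_toSet).2 fun a' ha' => ?_
        have := Finset.mem_erase.1 ha'
        exact hdisj a ha a' this.2 this.1.symm
      refine measure_mono_null (fun y hy => ?_) (volume_drop_image_eq_zero k hnull)
      simp only [mem_compl_iff, mem_ofPred_eq, not_forall] at hy
      obtain ⟨x, hx, rfl, hbad⟩ := hy
      refine ⟨x, ?_, rfl⟩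
      by_contra hcon
      simp only [mem_union, mem_ofPred_eq, mem_iUnion, not_or, not_exists, not_not, mem_inter_iff,
        not_and, Finset.mem_erase] at hcon
      exact hbad ⟨hk, hcon.1 hx, fun a' ha' hne => hcon.2 a' ⟨hne.symm, ha'⟩ hx⟩
  set A' := A.filter fun a => n a k ≠ 0 with hA'
  have hslice : ∀ᵐ y : Vec m, ∑ a ∈ A', (drop k '' F a).indicator
      (fun y => (SignType.sign (n a k) : ℝ) * g (graph k (n a) (b a) y)) y =
      g.linear (EuclideanSpace.single k 1) * (volume {t | ins k t y ∈ K}).toReal := by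
    filter_upwards [hgood] with y hy
    set e : ι → ℝ := fun a => graph k (n a) (b a) y k with he
    have hins : ∀ a, ins k (e a) y = graph k (n a) (b a) y := fun a => by
      conv_rhs => rw [← ins_drop k (graph k (n a) (b a) y), drop_graph]
    set E := A'.filter fun a => y ∈ drop k '' F a with hE
    have hE_mem : ∀ a ∈ E, a ∈ A ∧ n a k ≠ 0 ∧ ins k (e a) y ∈ F a := by
      intro a ha
      simp only [hE, hA', Finset.mem_filter] at ha
      obtain ⟨⟨haA, hak⟩, x, hx, rfl⟩ := ha
      refine ⟨haA, hak, ?_⟩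
      rw [hins, ← eq_graph_drop k hak (hflat a haA x hx)]
      exact hx
    have hcont : Continuous fun t => ins k t y :=
      (continuous_ins k).comp (f := fun t : ℝ => (t, y)) (by fun_prop)
    have hdist : ∀ t s, dist (ins k t y) (ins k s y) = |t - s| := by
      intro t s
      rw [dist_eq_norm, ins_sub_ins, norm_smul]
      simp
    have hcomp : IsCompact {t | ins k t y ∈ K} := by
      refine Metric.isCompact_of_isClosed_isBounded (hK.isClosed.preimage hcont) ?_
      rw [Metric.isBounded_iff]
      obtain ⟨C, hC⟩ := Metric.isBounded_iff.1 hK.isBounded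
      refine ⟨C, fun t ht s hs => ?_⟩
      rw [Real.dist_eq, ← hdist]
      exact hC ht hs
    have h1d := sum_sign_of_finite_frontier E e (fun a => n a k) hcomp
      (by
        intro a ha a' ha' hee
        by_contra hne
        obtain ⟨h1, h2, h3⟩ := hE_mem a ha
        obtain ⟨h1', h2', h3'⟩ := hE_mem a' ha'
        refine (hy a h1 _ h3 (drop_ins k _ _)).2.2 a' h1' hne ?_
        rw [hee]; exact h3')
      (fun a ha => (hE_mem a ha).2.1)
      (by
        intro t ht
        have h1 : ins k t y ∈ frontier K := hcont.frontier_preimage_subset K ht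
        obtain ⟨a, ha, hx⟩ := hfr _ h1
        have h2 := hy a ha _ hx (drop_ins k _ _)
        refine ⟨a, ?_, ?_⟩
        · simp only [hE, hA', Finset.mem_filter]
          exact ⟨⟨ha, h2.1⟩, _, hx, drop_ins k _ _⟩
        · have h3 := eq_graph_drop k h2.1 (hflat a ha _ hx)
          rw [drop_ins] at h3
          have := congrArg (fun x : Vec (m + 1) => x k) h3
          simpa [he] using this)
      (by
        intro a ha
        obtain ⟨h1, h2, h3⟩ := hE_mem a ha
        obtain ⟨-, r, hr, hloc⟩ := (hy a h1 _ h3 (drop_ins k _ _)).2.1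
        filter_upwards [Metric.ball_mem_nhds (e a) hr] with t ht
        have h4 := hloc (ins k t y) (by
          rw [Metric.mem_ball, hdist]; simpa [Real.dist_eq] using ht)
        rw [ins_sub_ins, inner_smul_right, inner_single_one] at h4
        rw [mul_comm (n a k)]
        exact h4)
    have hg : ∀ a, g (graph k (n a) (b a) y) =
        g (ins k 0 y) + e a * g.linear (EuclideanSpace.single k 1) := by
      intro a
      have h1 := g.linearMap_vsub (ins k (e a) y) (ins k 0 y)
      rw [vsub_eq_sub, ins_sub_ins, sub_zero, map_smul, smul_eq_mul, vsub_eq_sub, hins] at h1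
      linarith
    have hsum : ∑ a ∈ A', (drop k '' F a).indicator
        (fun y => (SignType.sign (n a k) : ℝ) * g (graph k (n a) (b a) y)) y =
        ∑ a ∈ E, (SignType.sign (n a k) : ℝ) * g (graph k (n a) (b a) y) := by
      symm
      rw [hE, Finset.sum_filter]
      exact Finset.sum_congr rfl fun a _ => by simp only [indicator]
    rw [hsum, h1d.2, Finset.mul_sum]
    simp only [hg, mul_add]
    rw [Finset.sum_add_distrib, ← Finset.sum_mul, h1d.1, zero_mul, zero_add]
    exact Finset.sum_congr rfl fun a _ => by ring
  have hPc : ∀ a ∈ A, IsCompact (drop k '' F a) := fun a ha => (hF a ha).image (continuous_drop k)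
  have hint := integral_congr_ae hslice
  rw [integral_const_mul, ← (volume_eq_integral_slice k hK).2, integral_finsetSum] at hint
  · rw [← hint]
    have h1 : ∑ a ∈ A, n a k * ∫ x in F a, g x ∂μHE[m] =
        ∑ a ∈ A', n a k * ∫ x in F a, g x ∂μHE[m] := by
      rw [hA', Finset.sum_filter]
      refine Finset.sum_congr rfl fun a _ => ?_
      by_cases h : n a k = 0 <;> simp [h]
    rw [h1]
    refine Finset.sum_congr rfl fun a ha => ?_
    obtain ⟨haA, hak⟩ := Finset.mem_filter.1 ha
    rw [integral_indicator (hPc a haA).measurableSet, integral_const_mul,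
      ← setIntegral_flat k hak (hn a haA) (hflat a haA), ← mul_assoc, sign_mul_abs]
  · intro a ha
    obtain ⟨haA, hak⟩ := Finset.mem_filter.1 ha
    rw [integrable_indicator_iff (hPc a haA).measurableSet]
    refine ContinuousOn.integrableOn_compact (hPc a haA) (Continuous.continuousOn ?_)
    exact continuous_const.mul (hgc.comp (continuous_graph k _ _))

/-- Bounded flat sets have finite surface measure. -/
theorem euclideanHausdorffMeasure_flat_lt_top {m : ℕ} {n : Vec (m + 1)} (h1 : ‖n‖ = 1) {b : ℝ}
    {F : Set (Vec (m + 1))} (hF : ∀ x ∈ F, ⟪n, x⟫ = b) (hb : Bornology.IsBounded F) :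
    (μHE[m] : Measure (Vec (m + 1))) F < ⊤ := by
  obtain ⟨R, hR⟩ := hb.subset_closedBall 0
  refine (euclideanHausdorffMeasure_flat_le h1 hF (le_max_right R 0)
    (hR.trans (Metric.closedBall_subset_closedBall (le_max_left R 0)))).trans_lt ?_
  exact ENNReal.ofReal_lt_top

/-- A continuous function is integrable over a compact set of finite measure. -/
theorem integrableOn_of_continuousOn_compact {X E : Type*} [TopologicalSpace X] [MeasurableSpace X]
    [BorelSpace X] [T2Space X] [NormedAddCommGroup E] [SecondCountableTopologyEither X E]
    {μ : Measure X} {F : Set X}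
    (hF : IsCompact F) (hμ : μ F < ⊤) {u : X → E} (hu : ContinuousOn u F) : IntegrableOn u F μ := by
  obtain ⟨C, hC⟩ := hF.exists_bound_of_continuousOn hu
  exact IntegrableOn.of_bound hμ (hu.aestronglyMeasurable_of_isCompact hF hF.measurableSet) C
    (ae_restrict_of_forall_mem hF.measurableSet hC)

/-- The divergence of an affine vector field. -/
def affineDiv {d : ℕ} (T : Vec d →ᵃ[ℝ] Vec d) : ℝ :=
  ∑ k : Fin d, T.linear (EuclideanSpace.single k 1) k

/-- The divergence theorem for affine fields on a compact set whose boundary consists of finitely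
many flat faces, with outer normals in the sense of `IsOuterNormalAt`. -/
theorem divergence_flat_faces {m : ℕ} {ι : Type*} (A : Finset ι) {K : Set (Vec (m + 1))}
    (hK : IsCompact K) (F : ι → Set (Vec (m + 1))) (n : ι → Vec (m + 1)) (b : ι → ℝ)
    (hF : ∀ a ∈ A, IsCompact (F a)) (hn : ∀ a ∈ A, ‖n a‖ = 1)
    (hflat : ∀ a ∈ A, ∀ x ∈ F a, ⟪n a, x⟫ = b a)
    (hfr : ∀ x ∈ frontier K, ∃ a ∈ A, x ∈ F a)
    (hout : ∀ a ∈ A, ∀ᵐ x ∂(μHE[m] : Measure (Vec (m + 1))).restrict (F a),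
      IsOuterNormalAt K x (n a))
    (hdisj : ∀ a ∈ A, ∀ a' ∈ A, a ≠ a' → (μHE[m] : Measure (Vec (m + 1))) (F a ∩ F a') = 0)
    (T : Vec (m + 1) →ᵃ[ℝ] Vec (m + 1)) :
    ∑ a ∈ A, flux (F a) (n a) T = (volume K).toReal * affineDiv T := by
  let g : Fin (m + 1) → Vec (m + 1) →ᵃ[ℝ] ℝ := fun k =>
    (EuclideanSpace.proj k : Vec (m + 1) →L[ℝ] ℝ).toLinearMap.toAffineMap.comp T
  have hg : ∀ k x, g k x = T x k := fun k x => rfl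
  have hflux : ∀ a ∈ A, flux (F a) (n a) T = ∑ k, n a k * ∫ x in F a, g k x ∂μHE[m] := by
    intro a ha
    have hfin := euclideanHausdorffMeasure_flat_lt_top (hn a ha) (hflat a ha) (hF a ha).isBounded
    simp only [← integral_const_mul]
    rw [← integral_finsetSum]
    · unfold flux
      refine integral_congr_ae (ae_of_all _ fun x => ?_)
      simp [PiLp.inner_apply, hg]
    · intro k _
      refine Integrable.const_mul (IntegrableOn.integrable ?_) _
      exact integrableOn_of_continuousOn_compact (hF a ha) hfin
        (AffineMap.continuous_of_finiteDimensional (g k)).continuousOn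
  rw [Finset.sum_congr rfl hflux, Finset.sum_comm, affineDiv, Finset.mul_sum]
  refine Finset.sum_congr rfl fun k _ => ?_
  rw [divergence_flat_faces_coord A hK F n b hF hn hflat hfr hout hdisj (g k) k, mul_comm]
  rfl

/-! ### The uniform cone property of Lipschitz domains -/

/-- The uniform interior cone condition: near every point of the closure of `Ω` there is a common
axis `ν` such that the truncated open cones with axis `ν`, height `r` and aperture `θ` at all
nearby points of the closure lie in `Ω`. -/
def UniformCone {d : ℕ} (Ω : Set (Vec d)) (r θ : ℝ) : Prop :=
  ∀ x ∈ closure Ω, ∃ ν : Vec d, ‖ν‖ = 1 ∧ ∀ y ∈ closure Ω, dist y x ≤ r →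
    ∀ t, 0 < t → t ≤ r → ∀ w, ‖w‖ ≤ θ * t → y + t • ν + w ∈ Ω

theorem norm_sub_inner_smul_le {d : ℕ} {ν : Vec d} (hν : ‖ν‖ = 1) (w : Vec d) :
    ‖w - ⟪ν, w⟫ • ν‖ ≤ ‖w‖ := by
  have h := norm_sub_sq_real w (⟪ν, w⟫ • ν)
  rw [inner_smul_right, norm_smul, hν, mul_one, Real.norm_eq_abs, sq_abs,
    real_inner_comm ν w] at h
  refine (pow_le_pow_iff_left₀ (norm_nonneg _) (norm_nonneg _) two_ne_zero).1 ?_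
  have h' : ‖w - ⟪ν, w⟫ • ν‖ ^ 2 = ‖w‖ ^ 2 - ⟪ν, w⟫ ^ 2 := by
    rw [h]; ring
  rw [h']
  linarith [sq_nonneg ⟪ν, w⟫]

/-- The cone condition near a single point of the closure, from the local graph representation: the
aperture `1 / (L + 2)` is small enough for the Lipschitz constant `L` of the graph. -/
theorem IsLipschitzDomain.exists_cone_at {m : ℕ} {Ω : Set (Vec (m + 1))} (hΩ : IsLipschitzDomain Ω)
    {p : Vec (m + 1)} (hp : p ∈ closure Ω) :
    ∃ r > 0, ∃ θ > 0, θ ≤ 1 ∧ ∃ ν : Vec (m + 1), ‖ν‖ = 1 ∧ ∀ y ∈ closure Ω, dist y p ≤ 2 * r →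
      ∀ t, 0 < t → t ≤ r → ∀ w, ‖w‖ ≤ θ * t → y + t • ν + w ∈ Ω := by
  have hdist : ∀ {r θ : ℝ} {ν y w : Vec (m + 1)} {t : ℝ}, ‖ν‖ = 1 → θ ≤ 1 → dist y p ≤ 2 * r →
      0 < t → t ≤ r → ‖w‖ ≤ θ * t → dist (y + t • ν + w) p ≤ 4 * r := by
    intro r θ ν y w t hν hθ hy ht htr hw
    rw [dist_eq_norm] at hy ⊢
    have h1 : y + t • ν + w - p = (y - p) + t • ν + w := by abel
    rw [h1]
    refine (norm_add₃_le).trans ?_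
    rw [norm_smul, hν, Real.norm_eq_abs, abs_of_pos ht]
    nlinarith
  by_cases hpΩ : p ∈ Ω
  · obtain ⟨R, hR, hball⟩ := Metric.isOpen_iff.1 hΩ.isOpen p hpΩ
    have hν : ‖EuclideanSpace.single (0 : Fin (m + 1)) (1 : ℝ)‖ = 1 := by simp
    refine ⟨R / 8, by positivity, 1, one_pos, le_rfl, _, hν, fun y _ hyp t ht htr w hw =>
      hball ?_⟩
    rw [Metric.mem_ball]
    have := hdist hν le_rfl hyp ht htr hw
    linarith
  · have hpf : p ∈ frontier Ω := ⟨hp, fun h => hpΩ (interior_subset h)⟩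
    obtain ⟨ν, hν, R, hR, L, ψ, hψ, hchart⟩ := hΩ.lipschitz_boundary p hpf
    have hL : (0 : ℝ) ≤ L := L.2
    have hθ1 : 1 / ((L : ℝ) + 2) ≤ 1 := by
      rw [div_le_one (by positivity)]; linarith
    refine ⟨R / 8, by positivity, 1 / (L + 2), by positivity, hθ1, ν, hν,
      fun y hy hyp t ht htr w hw => ?_⟩
    have hd := hdist hν hθ1 hyp ht htr hw
    rw [hchart _ (by rw [Metric.mem_ball]; linarith)]
    -- the inequality that describes `Ω` holds weakly on its closure
    have hyψ : ψ (y - ⟪ν, y⟫ • ν) ≤ ⟪ν, y⟫ := by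
      by_contra! hlt
      have hopen : IsOpen (Metric.ball p R ∩ {z | ⟪ν, z⟫ < ψ (z - ⟪ν, z⟫ • ν)}) := by
        refine Metric.isOpen_ball.inter (isOpen_lt (by fun_prop) ?_)
        exact hψ.continuous.comp (by fun_prop)
      obtain ⟨z, ⟨hz1, hz2⟩, hzΩ⟩ := mem_closure_iff.1 hy _ hopen
        ⟨by rw [Metric.mem_ball]; linarith, hlt⟩
      exact lt_asymm hz2 ((hchart z hz1).1 hzΩ)
    have hνν : ⟪ν, ν⟫ = 1 := by rw [real_inner_self_eq_norm_sq, hν]; norm_num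
    have hin : ⟪ν, y + t • ν + w⟫ = ⟪ν, y⟫ + t + ⟪ν, w⟫ := by
      rw [inner_add_right, inner_add_right, inner_smul_right, hνν, mul_one]
    have hperp : y + t • ν + w - ⟪ν, y + t • ν + w⟫ • ν =
        (y - ⟪ν, y⟫ • ν) + (w - ⟪ν, w⟫ • ν) := by
      rw [hin]; module
    have hlip := hψ.dist_le_mul ((y - ⟪ν, y⟫ • ν) + (w - ⟪ν, w⟫ • ν)) (y - ⟪ν, y⟫ • ν)
    rw [dist_eq_norm, dist_eq_norm, add_sub_cancel_left, Real.norm_eq_abs] at hlip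
    have h1 := (abs_le.1 hlip).2
    have h2 : (L : ℝ) * ‖w - ⟪ν, w⟫ • ν‖ ≤ L * ‖w‖ := by
      gcongr; exact norm_sub_inner_smul_le hν w
    have h3 : |⟪ν, w⟫| ≤ ‖w‖ := by simpa [hν] using abs_real_inner_le_norm ν w
    have h4 := (abs_le.1 h3).1
    rw [hperp, hin]
    have h5 : ‖w‖ * (L + 2) ≤ t := by
      have := mul_le_mul_of_nonneg_right hw (by positivity : (0 : ℝ) ≤ L + 2)
      rwa [one_div, mul_right_comm, inv_mul_cancel₀ (by positivity), one_mul] at this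
    rcases eq_or_lt_of_le (norm_nonneg w) with h0 | h0
    · rw [← h0] at h2 h4; linarith
    · nlinarith

/-- Lipschitz domains have the uniform cone property, by compactness of the closure. -/
theorem IsLipschitzDomain.exists_uniformCone {m : ℕ} {Ω : Set (Vec (m + 1))}
    (hΩ : IsLipschitzDomain Ω) : ∃ r > 0, ∃ θ > 0, θ ≤ 1 ∧ UniformCone Ω r θ := by
  have hcomp : IsCompact (closure Ω) := hΩ.isBounded.isCompact_closure
  refine hcomp.induction_on (p := fun s => ∃ r > 0, ∃ θ > 0, θ ≤ 1 ∧
    ∀ x ∈ s, ∃ ν : Vec (m + 1), ‖ν‖ = 1 ∧ ∀ y ∈ closure Ω, dist y x ≤ r →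
    ∀ t, 0 < t → t ≤ r → ∀ w, ‖w‖ ≤ θ * t → y + t • ν + w ∈ Ω) ?_ ?_ ?_ ?_
  · exact ⟨1, one_pos, 1, one_pos, le_rfl, by simp⟩
  · rintro s t hst ⟨r, hr, θ, hθ, hθ1, h⟩
    exact ⟨r, hr, θ, hθ, hθ1, fun x hx => h x (hst hx)⟩
  · rintro s s' ⟨r, hr, θ, hθ, hθ1, h⟩ ⟨r', hr', θ', hθ', hθ1', h'⟩
    refine ⟨min r r', lt_min hr hr', min θ θ', lt_min hθ hθ', (min_le_left _ _).trans hθ1, ?_⟩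
    rintro x (hx | hx)
    · obtain ⟨ν, hν, hx⟩ := h x hx
      refine ⟨ν, hν, fun y hy hyx t ht htr w hw => hx y hy (hyx.trans (min_le_left _ _)) t ht
        (htr.trans (min_le_left _ _)) w (hw.trans ?_)⟩
      gcongr; exact min_le_left _ _
    · obtain ⟨ν, hν, hx⟩ := h' x hx
      refine ⟨ν, hν, fun y hy hyx t ht htr w hw => hx y hy (hyx.trans (min_le_right _ _)) t ht
        (htr.trans (min_le_right _ _)) w (hw.trans ?_)⟩
      gcongr; exact min_le_right _ _
  · intro p hp
    obtain ⟨r, hr, θ, hθ, hθ1, ν, hν, h⟩ := hΩ.exists_cone_at hp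
    refine ⟨Metric.ball p r, mem_nhdsWithin_of_mem_nhds (Metric.ball_mem_nhds p hr),
      r, hr, θ, hθ, hθ1, fun x hx => ⟨ν, hν, fun y hy hyx => h y hy ?_⟩⟩
    have := dist_triangle y x p
    have := Metric.mem_ball.1 hx
    linarith

/-- A domain with the cone property does not lie on both sides of its boundary. -/
theorem UniformCone.closure_notMem_nhds {d : ℕ} {Ω : Set (Vec d)} {r θ : ℝ}
    (h : UniformCone Ω r θ) (hr : 0 < r) (hθ : 0 < θ) (hΩ : IsOpen Ω) {x : Vec d}
    (hx : x ∈ frontier Ω) : closure Ω ∉ nhds x := by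
  intro hnhds
  obtain ⟨ν, hν, hcone⟩ := h x hx.1
  obtain ⟨ε, hε, hball⟩ := Metric.mem_nhds_iff.1 hnhds
  set t := min r (ε / 2) with ht
  have ht0 : 0 < t := lt_min hr (by positivity)
  have hd : dist (x - t • ν) x = t := by
    rw [dist_eq_norm, sub_sub_cancel_left, norm_neg, norm_smul, hν, Real.norm_eq_abs,
      abs_of_pos ht0, mul_one]
  have hy : x - t • ν ∈ closure Ω := hball (by
    rw [Metric.mem_ball, hd]
    exact (min_le_right _ _).trans_lt (by linarith))
  have := hcone _ hy (hd.le.trans (min_le_left _ _)) t ht0 (min_le_left _ _) 0 (by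
    rw [norm_zero]; positivity)
  rw [sub_add_cancel, add_zero] at this
  rw [hΩ.frontier_eq] at hx
  exact hx.2 this

theorem UniformCone.uniqueDiffWithinAt {d : ℕ} {Ω : Set (Vec d)} {r θ : ℝ}
    (h : UniformCone Ω r θ) (hr : 0 < r) (hθ : 0 < θ) {x : Vec d}
    (hx : x ∈ closure Ω) : UniqueDiffWithinAt ℝ (closure Ω) x := by
  obtain ⟨ν, hν, hcone⟩ := h x hx
  -- the truncated cone at `x` is convex with nonempty interior and contained in the closure
  have hconv : Convex ℝ {y : Vec d | ∃ t ∈ Icc 0 r, ‖y - x - t • ν‖ ≤ θ * t} := by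
    rintro y ⟨t, ht, hyt⟩ z ⟨s, hs, hzs⟩ a b ha hb hab
    refine ⟨a * t + b * s, ⟨by have := ht.1; have := hs.1; positivity, ?_⟩, ?_⟩
    · have := ht.2; have := hs.2; nlinarith
    · have : a • y + b • z - x - (a * t + b * s) • ν =
          a • (y - x - t • ν) + b • (z - x - s • ν) := by
        have hx1 : x = a • x + b • x := by rw [← add_smul, hab, one_smul]
        conv_lhs => rw [hx1]
        module
      rw [this]
      refine (norm_add_le _ _).trans ?_
      rw [norm_smul, norm_smul, Real.norm_of_nonneg ha, Real.norm_of_nonneg hb]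
      nlinarith
  have hmem : x ∈ {y : Vec d | ∃ t ∈ Icc 0 r, ‖y - x - t • ν‖ ≤ θ * t} :=
    ⟨0, ⟨le_rfl, hr.le⟩, by simp⟩
  have hint : (interior {y : Vec d | ∃ t ∈ Icc 0 r, ‖y - x - t • ν‖ ≤ θ * t}).Nonempty := by
    refine ⟨x + r • ν, mem_interior.2 ⟨Metric.ball (x + r • ν) (θ * r), ?_, Metric.isOpen_ball,
      Metric.mem_ball_self (by positivity)⟩⟩
    intro y hy
    refine ⟨r, ⟨hr.le, le_rfl⟩, ?_⟩
    rw [Metric.mem_ball, dist_eq_norm, ← sub_sub] at hy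
    exact hy.le
  refine (uniqueDiffWithinAt_convex hconv hint (subset_closure hmem)).mono ?_
  rintro y ⟨t, ht, hyt⟩
  rcases eq_or_lt_of_le ht.1 with h0 | h0
  · rw [← h0] at hyt
    simp only [zero_smul, sub_zero, mul_zero] at hyt
    rw [sub_eq_zero.1 (norm_le_zero_iff.1 hyt)]
    exact hx
  · have := hcone x hx (by simpa using hr.le) t h0 ht.2 (y - x - t • ν) hyt
    refine subset_closure ?_
    convert this using 1
    abel

/-! ### Outer normals -/

section
variable {d : ℕ} {K K' : Set (Vec d)} {x n n' : Vec d}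

open Filter Topology in
theorem IsOuterNormalAt.eventually_mem_interior (h : IsOuterNormalAt K x n) {v : Vec d}
    (hv : ⟪n, v⟫ < 0) : ∀ᶠ t : ℝ in 𝓝[>] 0, x + t • v ∈ interior K := by
  obtain ⟨-, r, hr, hK⟩ := h
  have hcont : Tendsto (fun t : ℝ => x + t • v) (𝓝[>] 0) (𝓝 x) := by
    have : Tendsto (fun t : ℝ => x + t • v) (𝓝 0) (𝓝 (x + (0 : ℝ) • v)) :=
      (by fun_prop : Continuous fun t : ℝ => x + t • v).tendsto 0
    rw [zero_smul, add_zero] at this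
    exact this.mono_left nhdsWithin_le_nhds
  filter_upwards [hcont (Metric.ball_mem_nhds x hr), self_mem_nhdsWithin] with t ht ht0
  refine mem_interior.2 ⟨Metric.ball x r ∩ {y | ⟪n, y - x⟫ < 0}, ?_,
    Metric.isOpen_ball.inter (isOpen_lt (by fun_prop) continuous_const), ht, ?_⟩
  · rintro y ⟨hy1, hy2⟩
    exact (hK y hy1).2 (le_of_lt hy2)
  · simp only [mem_ofPred_eq, add_sub_cancel_left, inner_smul_right]
    exact mul_neg_of_pos_of_neg ht0 hv

open Filter Topology in
theorem IsOuterNormalAt.eventually_notMem (h : IsOuterNormalAt K x n) {v : Vec d}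
    (hv : 0 < ⟪n, v⟫) : ∀ᶠ t : ℝ in 𝓝[>] 0, x + t • v ∉ K := by
  obtain ⟨-, r, hr, hK⟩ := h
  have hcont : Tendsto (fun t : ℝ => x + t • v) (𝓝[>] 0) (𝓝 x) := by
    have : Tendsto (fun t : ℝ => x + t • v) (𝓝 0) (𝓝 (x + (0 : ℝ) • v)) :=
      (by fun_prop : Continuous fun t : ℝ => x + t • v).tendsto 0
    rw [zero_smul, add_zero] at this
    exact this.mono_left nhdsWithin_le_nhds
  filter_upwards [hcont (Metric.ball_mem_nhds x hr), self_mem_nhdsWithin] with t ht ht0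
  rw [hK _ ht, add_sub_cancel_left, inner_smul_right, not_le]
  exact mul_pos ht0 hv

theorem inner_lt_one_of_ne (hn : ‖n‖ = 1) (hn' : ‖n'‖ = 1) (hne : n ≠ n') : ⟪n, n'⟫ < 1 := by
  have h := norm_sub_sq_real n n'
  have : 0 < ‖n - n'‖ := norm_pos_iff.2 (sub_ne_zero.2 hne)
  rw [hn, hn'] at h
  nlinarith

theorem IsOuterNormalAt.unique (h : IsOuterNormalAt K x n) (h' : IsOuterNormalAt K x n') :
    n = n' := by
  by_contra hne
  have hlt := inner_lt_one_of_ne h.1 h'.1 hne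
  have h1 : 0 < ⟪n, n - n'⟫ := by
    rw [inner_sub_right, real_inner_self_eq_norm_sq, h.1]; linarith
  have h2 : ⟪n', n - n'⟫ < 0 := by
    rw [inner_sub_right, real_inner_self_eq_norm_sq, h'.1, real_inner_comm]; linarith
  obtain ⟨t, ht, ht'⟩ := ((h.eventually_notMem h1).and (h'.eventually_mem_interior h2)).exists
  exact ht (interior_subset ht')

theorem IsOuterNormalAt.eq_neg (h : IsOuterNormalAt K x n) (h' : IsOuterNormalAt K' x n')
    (hdisj : Disjoint (interior K) (interior K')) : n' = -n := by
  by_contra hne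
  have hlt := inner_lt_one_of_ne h'.1 (by rw [norm_neg]; exact h.1 : ‖-n‖ = 1) hne
  rw [inner_neg_right] at hlt
  have h1 : ⟪n, -(n + n')⟫ < 0 := by
    rw [inner_neg_right, inner_add_right, real_inner_self_eq_norm_sq, h.1, real_inner_comm]
    linarith
  have h2 : ⟪n', -(n + n')⟫ < 0 := by
    rw [inner_neg_right, inner_add_right, real_inner_self_eq_norm_sq, h'.1]
    linarith
  obtain ⟨t, ht, ht'⟩ :=
    ((h.eventually_mem_interior h1).and (h'.eventually_mem_interior h2)).exists
  exact disjoint_left.1 hdisj ht ht'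

/-- Two bodies that meet at a common regular boundary point fill a neighbourhood of it. -/
theorem IsOuterNormalAt.union_mem_nhds (h : IsOuterNormalAt K x n) (h' : IsOuterNormalAt K' x n')
    (hdisj : Disjoint (interior K) (interior K')) : K ∪ K' ∈ nhds x := by
  have hnn := h.eq_neg h' hdisj
  obtain ⟨-, r, hr, hK⟩ := h
  obtain ⟨-, r', hr', hK'⟩ := h'
  filter_upwards [Metric.ball_mem_nhds x hr, Metric.ball_mem_nhds x hr'] with y hy hy'
  rcases le_total ⟪n, y - x⟫ 0 with h0 | h0
  · exact Or.inl ((hK y hy).2 h0)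
  · refine Or.inr ((hK' y hy').2 ?_)
    rw [hnn, inner_neg_left]
    linarith

theorem outerNormal_eq (h : IsOuterNormalAt K x n) : outerNormal K x = n := by
  have hex : ∃ n, IsOuterNormalAt K x n := ⟨n, h⟩
  rw [outerNormal, dif_pos hex]
  exact hex.choose_spec.unique h

end

/-- Additivity of the integral over a finite union of sets with null intersections. -/
theorem setIntegral_biUnion_finset_of_aedisjoint {X ι E : Type*} [MeasurableSpace X]
    [NormedAddCommGroup E] [NormedSpace ℝ E] {μ : Measure X} (A : Finset ι) {s : ι → Set X}
    {f : X → E} (hs : ∀ a ∈ A, MeasurableSet (s a))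
    (hd : ∀ a ∈ A, ∀ b ∈ A, a ≠ b → μ (s a ∩ s b) = 0) (hf : ∀ a ∈ A, IntegrableOn f (s a) μ) :
    ∫ x in ⋃ a ∈ A, s a, f x ∂μ = ∑ a ∈ A, ∫ x in s a, f x ∂μ := by
  classical
  induction A using Finset.induction_on with
  | empty => simp
  | insert a A ha ih =>
    rw [Finset.sum_insert ha, ← ih (fun b hb => hs b (Finset.mem_insert_of_mem hb))
      (fun b hb c hc => hd b (Finset.mem_insert_of_mem hb) c (Finset.mem_insert_of_mem hc))
      (fun b hb => hf b (Finset.mem_insert_of_mem hb)), Finset.set_biUnion_insert]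
    refine setIntegral_union₀ ?_ ?_ (hf a (Finset.mem_insert_self a A)) ?_
    · rw [AEDisjoint, inter_iUnion₂]
      refine (measure_biUnion_null_iff A.countable_toSet).2 fun b hb => ?_
      exact hd a (Finset.mem_insert_self a A) b (Finset.mem_insert_of_mem hb)
        fun h => ha (h ▸ hb)
    · exact (A.measurableSet_biUnion fun b hb =>
        hs b (Finset.mem_insert_of_mem hb)).nullMeasurableSet
    · exact (integrableOn_finset_iUnion).2 fun b hb => hf b (Finset.mem_insert_of_mem hb)

theorem flux_neg {d : ℕ} (f : Set (Vec d)) (n : Vec d) (u : Vec d → Vec d) :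
    flux f (-n) u = -flux f n u := by
  simp only [flux, inner_neg_right, integral_neg]

/-- A double sum over neighbouring pairs of an antisymmetric quantity vanishes. -/
theorem sum_filter_antisymm_eq_zero {ι : Type*} (S : Finset ι)
    (G : ι → ι → ℝ) (P : ι → ι → Prop) [∀ i j, Decidable (P i j)]
    (hP : ∀ i ∈ S, ∀ j ∈ S, P i j → P j i) (hG : ∀ i j, P i j → G j i = -G i j) :
    ∑ i ∈ S, ∑ j ∈ S with P i j, G i j = 0 := by
  have h1 : ∑ i ∈ S, ∑ j ∈ S with P i j, G i j =
      ∑ i ∈ S, ∑ j ∈ S, if P i j then G i j else 0 :=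
    Finset.sum_congr rfl fun i _ => Finset.sum_filter _ _
  have h2 : ∑ i ∈ S, ∑ j ∈ S, (if P i j then G i j else 0) =
      -∑ i ∈ S, ∑ j ∈ S, (if P i j then G i j else 0) := by
    conv_lhs => rw [Finset.sum_comm]
    rw [← Finset.sum_neg_distrib]
    refine Finset.sum_congr rfl fun j hj => ?_
    rw [← Finset.sum_neg_distrib]
    refine Finset.sum_congr rfl fun i hi => ?_
    by_cases h : P i j
    · rw [if_pos h, if_pos (hP i hi j hj h), hG i j h, neg_neg]
    · rw [if_neg h, if_neg fun h' => h (hP j hj i hi h'), neg_zero]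
  rw [h1]
  linarith

namespace DualMesh

/-! ### Geometry of dual meshes -/

section
variable {d N : ℕ} {Ω : Set (Vec d)} (M : DualMesh Ω N)

theorem isClosed_cell (i : Fin N) : IsClosed (M.cell i) := by
  rw [← M.cell_regular i]; exact isClosed_closure

theorem cell_subset_closure (i : Fin N) : M.cell i ⊆ closure Ω := by
  rw [← M.cell_cover]; exact subset_iUnion _ i

theorem isCompact_cell (hΩ : Bornology.IsBounded Ω) (i : Fin N) : IsCompact (M.cell i) :=
  hΩ.isCompact_closure.of_isClosed_subset (M.isClosed_cell i) (M.cell_subset_closure i)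

theorem pt_mem_closure (i : Fin N) : M.pt i ∈ closure Ω := M.cell_subset_closure i (M.pt_mem_cell i)

theorem vol_pos (hΩ : Bornology.IsBounded Ω) (i : Fin N) : 0 < M.vol i := by
  have h : (interior (M.cell i)).Nonempty := by
    rw [← closure_nonempty_iff, M.cell_regular]; exact ⟨_, M.pt_mem_cell i⟩
  exact ENNReal.toReal_pos
    ((isOpen_interior.measure_pos volume h).trans_le (measure_mono interior_subset)).ne'
    (M.isCompact_cell hΩ i).measure_ne_top

theorem isClosed_face (i j : Fin N) : IsClosed (M.face i j) := isClosed_frontier.inter isClosed_frontier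

theorem isClosed_bdryFace (i : Fin N) : IsClosed (M.bdryFace i) :=
  isClosed_frontier.inter isClosed_frontier

theorem face_subset_cell (i j : Fin N) : M.face i j ⊆ M.cell i :=
  inter_subset_left.trans (M.isClosed_cell i).frontier_subset

theorem bdryFace_subset_cell (i : Fin N) : M.bdryFace i ⊆ M.cell i :=
  inter_subset_left.trans (M.isClosed_cell i).frontier_subset

theorem isCompact_face (hΩ : Bornology.IsBounded Ω) (i j : Fin N) : IsCompact (M.face i j) :=
  (M.isCompact_cell hΩ i).of_isClosed_subset (M.isClosed_face i j) (M.face_subset_cell i j)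

theorem isCompact_bdryFace (hΩ : Bornology.IsBounded Ω) (i : Fin N) : IsCompact (M.bdryFace i) :=
  (M.isCompact_cell hΩ i).of_isClosed_subset (M.isClosed_bdryFace i) (M.bdryFace_subset_cell i)

theorem face_comm (i j : Fin N) : M.face i j = M.face j i := inter_comm _ _

theorem ae_face {i j : Fin N} (h : j ∈ M.nbr i) : ∀ᵐ x ∂(μHE[d - 1] : Measure (Vec d)),
    x ∈ M.face i j → IsOuterNormalAt (M.cell i) x (M.normal i j) :=
  (ae_restrict_iff' (M.isClosed_face i j).measurableSet).1 (M.normal_outer i j h)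

theorem ae_bdryFace {i : Fin N} (h : i ∈ M.bdry) : ∀ᵐ x ∂(μHE[d - 1] : Measure (Vec d)),
    x ∈ M.bdryFace i → IsOuterNormalAt (M.cell i) x (M.bdryNormal i) :=
  (ae_restrict_iff' (M.isClosed_bdryFace i).measurableSet).1 (M.bdryNormal_outer i h)

theorem exists_of_ae_of_pos {X : Type*} [MeasurableSpace X] {μ : Measure X} {s : Set X}
    {p : X → Prop} (hs : 0 < μ s) (h : ∀ᵐ x ∂μ, p x) : ∃ x ∈ s, p x := by
  by_contra! hcon
  exact hs.ne' (measure_mono_null (fun x hx => hcon x hx) h)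

theorem norm_normal {i j : Fin N} (h : j ∈ M.nbr i) : ‖M.normal i j‖ = 1 := by
  obtain ⟨x, hx, hx'⟩ := exists_of_ae_of_pos (M.face_pos i j h) (M.ae_face h)
  exact (hx' hx).1

theorem norm_bdryNormal {i : Fin N} (h : i ∈ M.bdry) : ‖M.bdryNormal i‖ = 1 := by
  obtain ⟨x, hx, hx'⟩ := exists_of_ae_of_pos (M.bdryFace_pos i h) (M.ae_bdryFace h)
  exact (hx' hx).1

theorem ne_of_mem_nbr {i j : Fin N} (h : j ∈ M.nbr i) : i ≠ j := fun hij =>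
  M.nbr_irrefl i (by rwa [← hij] at h)

theorem normal_symm {i j : Fin N} (h : j ∈ M.nbr i) : M.normal j i = -M.normal i j := by
  obtain ⟨x, hx, hx', hx''⟩ := exists_of_ae_of_pos (M.face_pos i j h)
    ((M.ae_face h).and (M.ae_face (M.nbr_symm i j h)))
  exact (hx' hx).eq_neg (hx'' (by rw [M.face_comm]; exact hx))
    (M.cell_disjoint i j (M.ne_of_mem_nbr h))

/-- Three cells cannot meet at a point where each of them has an outer normal. -/
theorem measure_face_inter_face {i j k : Fin N} (hj : j ∈ M.nbr i) (hk : k ∈ M.nbr i)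
    (hjk : j ≠ k) : (μHE[d - 1] : Measure (Vec d)) (M.face i j ∩ M.face i k) = 0 := by
  refine measure_mono_null ?_ (((M.ae_face hj).and ((M.ae_face hk).and ((M.ae_face
    (M.nbr_symm i j hj)).and (M.ae_face (M.nbr_symm i k hk))))))
  rintro x ⟨hxj, hxk⟩ ⟨h1, h2, h3, h4⟩
  have h1 := h1 hxj
  have h3 := h3 (by rw [M.face_comm]; exact hxj)
  have h4 := h4 (by rw [M.face_comm]; exact hxk)
  have e1 := h1.eq_neg h3 (M.cell_disjoint i j (M.ne_of_mem_nbr hj))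
  have e2 := h1.eq_neg h4 (M.cell_disjoint i k (M.ne_of_mem_nbr hk))
  have e3 := h3.eq_neg h4 (M.cell_disjoint j k hjk)
  have h0 : M.normal i j = 0 := by
    rw [e2, e1, neg_neg] at e3
    have h2 : (2 : ℝ) • M.normal i j = 0 := by
      rw [two_smul, add_eq_zero_iff_eq_neg]; exact e3.symm
    exact (smul_eq_zero.1 h2).resolve_left two_ne_zero
  have := h1.1
  rw [h0, norm_zero] at this
  exact zero_ne_one this

/-- The two cells at a regular point of a face fill a neighbourhood of it within the closure of `Ω`,
so that such a point is not on the boundary of `Ω`. -/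
theorem measure_face_inter_bdryFace {r θ : ℝ} (hcone : UniformCone Ω r θ) (hr : 0 < r)
    (hθ : 0 < θ) (hΩ : IsOpen Ω) {i j : Fin N} (hj : j ∈ M.nbr i) :
    (μHE[d - 1] : Measure (Vec d)) (M.face i j ∩ M.bdryFace i) = 0 := by
  refine measure_mono_null ?_ ((M.ae_face hj).and (M.ae_face (M.nbr_symm i j hj)))
  rintro x ⟨hxj, hxi⟩ ⟨h1, h2⟩
  refine hcone.closure_notMem_nhds hr hθ hΩ hxi.2 (Filter.mem_of_superset
    ((h1 hxj).union_mem_nhds (h2 (by rw [M.face_comm]; exact hxj))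
      (M.cell_disjoint i j (M.ne_of_mem_nbr hj))) ?_)
  exact union_subset (M.cell_subset_closure i) (M.cell_subset_closure j)

theorem measure_bdryFace_inter_bdryFace {r θ : ℝ} (hcone : UniformCone Ω r θ) (hr : 0 < r)
    (hθ : 0 < θ) (hΩ : IsOpen Ω) {i j : Fin N} (hi : i ∈ M.bdry) (hj : j ∈ M.bdry) (hij : i ≠ j) :
    (μHE[d - 1] : Measure (Vec d)) (M.bdryFace i ∩ M.bdryFace j) = 0 := by
  refine measure_mono_null ?_ ((M.ae_bdryFace hi).and (M.ae_bdryFace hj))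
  rintro x ⟨hxi, hxj⟩ ⟨h1, h2⟩
  refine hcone.closure_notMem_nhds hr hθ hΩ hxi.2 (Filter.mem_of_superset
    ((h1 hxi).union_mem_nhds (h2 hxj) (M.cell_disjoint i j hij)) ?_)
  exact union_subset (M.cell_subset_closure i) (M.cell_subset_closure j)

/-- A face between a cell of `S` and a cell outside of `S` lies on the boundary of the union of the
cells of `S`. -/
theorem face_subset_frontier_biUnion {S : Finset (Fin N)} {i j : Fin N} (hi : i ∈ S) (hj : j ∉ S) :
    M.face i j ⊆ frontier (⋃ k ∈ S, M.cell k) := by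
  intro x hx
  refine ⟨subset_closure (mem_biUnion hi (M.face_subset_cell i j hx)), fun hint => ?_⟩
  have hxj : x ∈ closure (interior (M.cell j)) := by
    rw [M.cell_regular]; rw [M.face_comm] at hx; exact M.face_subset_cell j i hx
  obtain ⟨y, hy1, hy2⟩ := mem_closure_iff.1 hxj _ isOpen_interior hint
  have hy3 := interior_subset hy1
  simp only [mem_iUnion] at hy3
  obtain ⟨k, hk, hyk⟩ := hy3
  rw [← M.cell_regular] at hyk
  exact disjoint_left.1 ((M.cell_disjoint k j fun h => hj (h ▸ hk)).closure_left isOpen_interior)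
    hyk hy2

/-- At almost every point of the boundary segment `Γ_i` its normal is the outer normal of `Ω`. -/
theorem ae_outerNormal_closure {r θ : ℝ} (hcone : UniformCone Ω r θ) (hr : 0 < r)
    (hθ : 0 < θ) (hΩ : IsOpen Ω) {i : Fin N} (hi : i ∈ M.bdry) :
    ∀ᵐ x ∂(μHE[d - 1] : Measure (Vec d)), x ∈ M.bdryFace i →
      IsOuterNormalAt (closure Ω) x (M.bdryNormal i) := by
  have hdis : ∀ᵐ x ∂(μHE[d - 1] : Measure (Vec d)), ∀ j ∈ M.bdry, i ≠ j →
      x ∉ M.bdryFace i ∩ M.bdryFace j := by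
    rw [Filter.eventually_all_finset]
    intro j hj
    by_cases hij : i = j
    · simp [hij]
    · have := M.measure_bdryFace_inter_bdryFace hcone hr hθ hΩ hi hj hij
      filter_upwards [measure_eq_zero_iff_ae_notMem.1 this] with x hx _
      exact hx
  filter_upwards [hdis, M.ae_bdryFace hi] with x hx1 hx2 hx
  obtain ⟨hn, ε, hε, hcell⟩ := hx2 hx
  have hclosed : IsClosed (⋃ j ∈ M.bdry.erase i, M.bdryFace j) :=
    (M.bdry.erase i).finite_toSet.isClosed_biUnion fun j _ => M.isClosed_bdryFace j
  have hxn : x ∉ ⋃ j ∈ M.bdry.erase i, M.bdryFace j := by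
    simp only [mem_iUnion, Finset.mem_erase, not_exists]
    rintro j ⟨hji, hj⟩ hxj
    exact hx1 j hj (Ne.symm hji) ⟨hx, hxj⟩
  obtain ⟨ε', hε', hball⟩ := Metric.isOpen_iff.1 hclosed.isOpen_compl x hxn
  refine ⟨hn, min ε ε', lt_min hε hε', fun y hy => ⟨fun hyΩ => ?_, fun hy0 => ?_⟩⟩
  swap
  · exact M.cell_subset_closure i ((hcell y (Metric.ball_subset_ball (min_le_left _ _) hy)).2 hy0)
  -- otherwise the opposite half-ball lies in `Ω` as well, on both sides of the boundary point `x`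
  by_contra! hpos
  obtain ⟨b, hb⟩ := M.bdryFace_affine i hi
  -- near `x` the boundary of `Ω` lies in the hyperplane of `Γ_i`
  have hfr : ∀ z ∈ Metric.ball x (min ε ε'), z ∈ frontier Ω → ⟪M.bdryNormal i, z - x⟫ = 0 := by
    intro z hz hzf
    rw [M.frontier_domain] at hzf
    simp only [mem_iUnion] at hzf
    obtain ⟨j, hj, hzj⟩ := hzf
    have hji : j = i := by
      by_contra hji
      refine hball (Metric.ball_subset_ball (min_le_right _ _) hz) ?_
      exact mem_biUnion (Finset.mem_erase.2 ⟨hji, hj⟩) hzj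
    subst hji
    rw [inner_sub_right, hb z hzj, hb x hx, sub_self]
  set U := Metric.ball x (min ε ε') ∩ {z | 0 < ⟪M.bdryNormal i, z - x⟫} with hU
  have hUconv : Convex ℝ U := by
    refine (convex_ball _ _).inter ?_
    have : {z | 0 < ⟪M.bdryNormal i, z - x⟫} = {z | ⟪M.bdryNormal i, x⟫ < ⟪M.bdryNormal i, z⟫} := by
      ext z; simp [inner_sub_right]
    rw [this]
    exact convex_halfSpace_gt (innerₗ (Vec d) (M.bdryNormal i)).isLinear _
  have hUnf : ∀ z ∈ U, z ∉ frontier Ω := fun z hz hzf =>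
    (show 0 < ⟪M.bdryNormal i, z - x⟫ from hz.2).ne' (hfr z hz.1 hzf)
  have hUsub : U ⊆ Ω := by
    refine hUconv.isPreconnected.subset_left_of_subset_union hΩ isClosed_closure.isOpen_compl
      (disjoint_left.2 fun z hz hz' => hz' (subset_closure hz)) (fun z hz => ?_) ⟨y, ⟨hy, hpos⟩, ?_⟩
    · by_contra hcon
      simp only [mem_union, mem_compl_iff, not_or, not_not] at hcon
      refine hUnf z hz ?_
      rw [hΩ.frontier_eq]
      exact ⟨hcon.2, hcon.1⟩
    · by_contra hcon
      refine hUnf y ⟨hy, hpos⟩ ?_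
      rw [hΩ.frontier_eq]
      exact ⟨hyΩ, hcon⟩
  refine hcone.closure_notMem_nhds hr hθ hΩ hx.2
    (Filter.mem_of_superset (Metric.ball_mem_nhds x (lt_min hε hε')) fun z hz => ?_)
  rcases le_or_gt ⟪M.bdryNormal i, z - x⟫ 0 with h0 | h0
  · exact M.cell_subset_closure i ((hcell z (Metric.ball_subset_ball (min_le_left _ _) hz)).2 h0)
  · exact subset_closure (hUsub ⟨hz, h0⟩)

/-! ### Conservation -/

theorem gmlsFlux_symm (γ : Finset (Fin N)) (ε : ℝ) (φ : P1Basis d) (uh : M.Samples γ)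
    {i j : Fin N} (h : j ∈ M.nbr i) :
    M.gmlsFlux γ ε φ (M.face j i) (M.normal j i) uh =
      -M.gmlsFlux γ ε φ (M.face i j) (M.normal i j) uh := by
  simp only [gmlsFlux, M.face_comm j i, M.normal_symm h, flux_neg, mul_neg, Finset.sum_neg_distrib]

theorem vol_mul_DIV (hΩ : Bornology.IsBounded Ω) (γ : Finset (Fin N)) (ε : ℝ) (φ : P1Basis d)
    (uh : M.Samples γ) (g : Vec d → Vec d) (i : Fin N) :
    M.vol i * M.DIV γ ε φ uh g i =
      ∑ j ∈ M.nbr i, M.gmlsFlux γ ε φ (M.face i j) (M.normal i j) uh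
      + (if i ∈ M.bdry \ γ then M.gmlsFlux γ ε φ (M.bdryFace i) (M.bdryNormal i) uh else 0)
      + (if i ∈ γ then flux (M.bdryFace i) (M.bdryNormal i) g else 0) := by
  rw [DIV, ← mul_assoc, mul_one_div_cancel (M.vol_pos hΩ i).ne', one_mul]

open Classical in
/-- Local conservation. The fluxes through faces that are not contained in the boundary of the union
of the cells of `S` occur in pairs of opposite sign. -/
theorem sum_vol_mul_DIV (hΩ : Bornology.IsBounded Ω) (γ : Finset (Fin N)) (ε : ℝ)
    (φ : P1Basis d) (uh : M.Samples γ) (g : Vec d → Vec d) (S : Finset (Fin N)) :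
    ∑ i ∈ S, M.vol i * M.DIV γ ε φ uh g i =
      ∑ i ∈ S, ∑ j ∈ M.nbr i with M.face i j ⊆ frontier (⋃ k ∈ S, M.cell k),
          M.gmlsFlux γ ε φ (M.face i j) (M.normal i j) uh
        + ∑ k ∈ S ∩ (M.bdry \ γ), M.gmlsFlux γ ε φ (M.bdryFace k) (M.bdryNormal k) uh
        + ∑ k ∈ S ∩ γ, flux (M.bdryFace k) (M.bdryNormal k) g := by
  simp only [M.vol_mul_DIV hΩ, Finset.sum_add_distrib]
  rw [Finset.sum_ite_mem, Finset.sum_ite_mem]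
  congr 2
  rw [← sub_eq_zero, ← Finset.sum_sub_distrib]
  have hzero := sum_filter_antisymm_eq_zero S
    (fun i j => M.gmlsFlux γ ε φ (M.face i j) (M.normal i j) uh)
    (fun i j => j ∈ M.nbr i ∧ ¬ M.face i j ⊆ frontier (⋃ k ∈ S, M.cell k))
    (fun i _ j _ h => ⟨M.nbr_symm i j h.1, by rw [M.face_comm]; exact h.2⟩)
    (fun i j h => M.gmlsFlux_symm γ ε φ uh h.1)
  rw [← hzero]
  refine Finset.sum_congr rfl fun i hi => ?_
  rw [sub_eq_iff_eq_add, ← Finset.sum_filter_add_sum_filter_not (M.nbr i)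
    (fun j => M.face i j ⊆ frontier (⋃ k ∈ S, M.cell k)), add_comm]
  congr 1
  refine Finset.sum_congr ?_ fun _ _ => rfl
  ext j
  simp only [Finset.mem_filter]
  constructor
  · rintro ⟨h1, h2⟩
    exact ⟨by_contra fun hj => h2 (M.face_subset_frontier_biUnion hi hj), h1, h2⟩
  · rintro ⟨-, h⟩
    exact h

end

/-- Global conservation: all fluxes through interior faces cancel, and the prescribed fluxes through
the segments `Γ_i` add up to the flux through the boundary of `Ω`. -/
theorem sum_vol_mul_DIV_univ {m N : ℕ} {Ω : Set (Vec (m + 1))} (M : DualMesh Ω N)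
    (hΩ : IsLipschitzDomain Ω) (ε : ℝ) (φ : P1Basis (m + 1)) (uh : M.Samples M.bdry)
    {u : Vec (m + 1) → Vec (m + 1)} (hu : ContinuousOn u (frontier Ω)) :
    ∑ i, M.vol i * M.DIV M.bdry ε φ uh u i = boundaryFlux Ω u := by
  classical
  obtain ⟨r, hr, θ, hθ, -, hcone⟩ := hΩ.exists_uniformCone
  simp only [M.vol_mul_DIV hΩ.isBounded, Finset.sum_add_distrib]
  have hzero := sum_filter_antisymm_eq_zero Finset.univ
    (fun i j => M.gmlsFlux M.bdry ε φ (M.face i j) (M.normal i j) uh)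
    (fun i j => j ∈ M.nbr i) (fun i _ j _ h => M.nbr_symm i j h)
    (fun i j h => M.gmlsFlux_symm M.bdry ε φ uh h)
  simp only [Finset.filter_univ_mem] at hzero
  rw [hzero, Finset.sum_ite_mem, Finset.sum_ite_mem]
  simp only [Finset.sdiff_self, Finset.inter_empty, Finset.sum_empty, Finset.univ_inter, zero_add]
  have hn : ∀ i ∈ M.bdry, ∀ᵐ x ∂(μHE[m] : Measure (Vec (m + 1))).restrict (M.bdryFace i),
      ⟪u x, outerNormal (closure Ω) x⟫ = ⟪u x, M.bdryNormal i⟫ := by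
    intro i hi
    rw [ae_restrict_iff' (M.isClosed_bdryFace i).measurableSet]
    filter_upwards [M.ae_outerNormal_closure hcone hr hθ hΩ.isOpen hi] with x hx hxi
    rw [outerNormal_eq (hx hxi)]
  have hint : ∀ i ∈ M.bdry, IntegrableOn (fun x => ⟪u x, outerNormal (closure Ω) x⟫)
      (M.bdryFace i) (μHE[m] : Measure (Vec (m + 1))) := by
    intro i hi
    obtain ⟨b, hb⟩ := M.bdryFace_affine i hi
    refine IntegrableOn.congr_fun_ae ?_ (Filter.EventuallyEq.symm (hn i hi))
    refine integrableOn_of_continuousOn_compact (M.isCompact_bdryFace hΩ.isBounded i)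
      (euclideanHausdorffMeasure_flat_lt_top (M.norm_bdryNormal hi) hb
        (M.isCompact_bdryFace hΩ.isBounded i).isBounded) ?_
    exact (hu.mono inter_subset_right).inner continuousOn_const
  have hfr : frontier Ω = ⋃ i ∈ M.bdry, M.bdryFace i := M.frontier_domain
  rw [boundaryFlux, hfr]
  refine Eq.trans ?_ (setIntegral_biUnion_finset_of_aedisjoint M.bdry
    (fun i _ => (M.isClosed_bdryFace i).measurableSet)
    (fun i hi j hj hij => M.measure_bdryFace_inter_bdryFace hcone hr hθ hΩ.isOpen hi hj hij)
    hint).symm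
  exact Finset.sum_congr rfl fun i hi => (integral_congr_ae (hn i hi)).symm

end DualMesh

/-! ### Taylor approximation up to the boundary -/

section
variable {d : ℕ} {Ω : Set (Vec d)} {u : Vec d → Vec d} {B : ℝ}

theorem norm_fderiv_sub_le_of_segment (hΩ : IsOpen Ω) (hu : ContDiffOn ℝ 2 u Ω)
    (hB : ∀ x ∈ Ω, ‖iteratedFDeriv ℝ 2 u x‖ ≤ B) {a b : Vec d} (hab : segment ℝ a b ⊆ Ω) :
    ‖fderiv ℝ u b - fderiv ℝ u a‖ ≤ B * ‖b - a‖ := by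
  refine (convex_segment a b).norm_image_sub_le_of_norm_hasFDerivWithin_le
    (f' := fun x => fderiv ℝ (fderiv ℝ u) x) (fun x hx => ?_) (fun x hx => ?_)
    (left_mem_segment ℝ a b) (right_mem_segment ℝ a b)
  · have h1 : ContDiffAt ℝ 1 (fderiv ℝ u) x :=
      ((hu x (hab hx)).contDiffAt (hΩ.mem_nhds (hab hx))).fderiv_right (by norm_num)
    exact (h1.differentiableAt one_ne_zero).hasFDerivAt.hasFDerivWithinAt
  · refine le_trans (le_of_eq ?_) (hB x (hab hx))
    rw [← norm_iteratedFDeriv_fderiv (n := 1), ← norm_iteratedFDeriv_fderiv (n := 0),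
      norm_iteratedFDeriv_zero]

theorem norm_sub_sub_le_of_segment (hΩ : IsOpen Ω) (hu : ContDiffOn ℝ 2 u Ω)
    {A : Vec d →L[ℝ] Vec d} {C : ℝ} {a b : Vec d} (hab : segment ℝ a b ⊆ Ω)
    (hC : ∀ x ∈ segment ℝ a b, ‖fderiv ℝ u x - A‖ ≤ C) :
    ‖u b - u a - A (b - a)‖ ≤ C * ‖b - a‖ := by
  refine (convex_segment a b).norm_image_sub_le_of_norm_hasFDerivWithin_le' (φ := A)
    (fun x hx => ?_) hC (left_mem_segment ℝ a b) (right_mem_segment ℝ a b)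
  exact (((hu x (hab hx)).contDiffAt (hΩ.mem_nhds (hab hx))).differentiableAt
    two_ne_zero).hasFDerivAt.hasFDerivWithinAt

theorem segment_vertical {y ν : Vec d} {s t : ℝ} {z : Vec d} (hs : 0 < s) (hst : s ≤ t)
    (hz : z ∈ segment ℝ (y + t • ν) (y + s • ν)) : ∃ τ, s ≤ τ ∧ τ ≤ t ∧ z = y + τ • ν := by
  obtain ⟨a, b, ha, hb, hab, rfl⟩ := hz
  refine ⟨a * t + b * s, ?_, ?_, ?_⟩
  · nlinarith
  · nlinarith
  · have h1 : y = a • y + b • y := by rw [← add_smul, hab, one_smul]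
    conv_rhs => rw [h1]
    module

/-- The first-order Taylor polynomial of `u` at the interior point `x + t ν` approximates `u` to
second order near `x`, up to the boundary: the points `x + t ν` and `y` are joined by a path of
length `O(t)` in `Ω`, from `x + t ν` to `y + t ν` and down the axis of the cone to `y`. -/
theorem norm_sub_taylor_le (hΩ : IsOpen Ω) (hu : ContDiffOn ℝ 2 u Ω)
    (huc : ContinuousOn u (closure Ω)) (hB : ∀ x ∈ Ω, ‖iteratedFDeriv ℝ 2 u x‖ ≤ B) {r θ : ℝ}
    (hθ1 : θ ≤ 1) {x ν : Vec d} (hx : x ∈ closure Ω) (hν : ‖ν‖ = 1)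
    (hcone : ∀ y ∈ closure Ω, dist y x ≤ r → ∀ t, 0 < t → t ≤ r → ∀ w, ‖w‖ ≤ θ * t →
      y + t • ν + w ∈ Ω) {t : ℝ} (ht : 0 < t) (htr : t ≤ r) {y : Vec d} (hy : y ∈ closure Ω)
    (hyx : dist y x ≤ θ * t) :
    ‖u y - (u (x + t • ν) + fderiv ℝ u (x + t • ν) (y - (x + t • ν)))‖ ≤ 3 * B * t ^ 2 := by
  set A := fderiv ℝ u (x + t • ν) with hA
  have hθt : θ * t ≤ t := by nlinarith
  have hB0 : 0 ≤ B := by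
    have hxΩ : x + t • ν ∈ Ω := by
      have := hcone x hx (by simpa using ht.le.trans htr) t ht htr 0 (by
        rw [norm_zero]; exact dist_nonneg.trans hyx)
      simpa using this
    exact (norm_nonneg _).trans (hB _ hxΩ)
  have hseg1 : segment ℝ (x + t • ν) (y + t • ν) ⊆ Ω := by
    rintro z ⟨a, b, ha, hb, hab, rfl⟩
    have h1 : a • (x + t • ν) + b • (y + t • ν) = x + t • ν + b • (y - x) := by
      have h2 : x + t • ν = a • (x + t • ν) + b • (x + t • ν) := by
        rw [← add_smul, hab, one_smul]
      conv_rhs => rw [h2]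
      module
    rw [h1]
    refine hcone x hx (by simpa using ht.le.trans htr) t ht htr _ ?_
    rw [norm_smul, Real.norm_of_nonneg hb, ← dist_eq_norm]
    have : b ≤ 1 := by linarith
    nlinarith [dist_nonneg (x := y) (y := x)]
  have hyr : dist y x ≤ r := hyx.trans (hθt.trans htr)
  have hvert : ∀ τ, 0 < τ → τ ≤ t → y + τ • ν ∈ Ω := fun τ h0 h1 => by
    have := hcone y hy hyr τ h0 (h1.trans htr) 0 (by
      rw [norm_zero]
      have : 0 ≤ θ := by
        by_contra! h
        have := dist_nonneg.trans hyx
        nlinarith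
      positivity)
    simpa using this
  have hseg2 : ∀ s, 0 < s → s ≤ t → segment ℝ (y + t • ν) (y + s • ν) ⊆ Ω := by
    intro s hs hst z hz
    obtain ⟨τ, h1, h2, rfl⟩ := segment_vertical hs hst hz
    exact hvert τ (hs.trans_le h1) h2
  have hyx' : ‖y + t • ν - (x + t • ν)‖ ≤ t := by
    rw [add_sub_add_right_eq_sub, ← dist_eq_norm]; exact hyx.trans hθt
  have hd1 : ∀ z ∈ segment ℝ (x + t • ν) (y + t • ν), ‖fderiv ℝ u z - A‖ ≤ B * t := by
    intro z hz
    refine (norm_fderiv_sub_le_of_segment hΩ hu hB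
      (((convex_segment _ _).segment_subset (left_mem_segment ℝ _ _) hz).trans hseg1)).trans ?_
    refine mul_le_mul_of_nonneg_left (le_trans ?_ hyx') hB0
    have := norm_sub_le_of_mem_segment hz
    simpa using this
  have hd2 : ∀ s, 0 < s → s ≤ t → ‖fderiv ℝ u (y + s • ν) - A‖ ≤ 2 * B * t := by
    intro s hs hst
    have h1 := norm_fderiv_sub_le_of_segment hΩ hu hB (hseg2 s hs hst)
    have h2 := hd1 _ (right_mem_segment ℝ _ _)
    have h3 : ‖y + s • ν - (y + t • ν)‖ ≤ t := by
      rw [add_sub_add_left_eq_sub, ← sub_smul, norm_smul, hν, mul_one, Real.norm_eq_abs, abs_le]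
      constructor <;> linarith
    have h4 := norm_sub_le_norm_sub_add_norm_sub (fderiv ℝ u (y + s • ν))
      (fderiv ℝ u (y + t • ν)) A
    have h5 : B * ‖y + s • ν - (y + t • ν)‖ ≤ B * t := mul_le_mul_of_nonneg_left h3 hB0
    linarith
  have e1 : ‖u (y + t • ν) - u (x + t • ν) - A (y - x)‖ ≤ B * t ^ 2 := by
    have := norm_sub_sub_le_of_segment hΩ hu hseg1 hd1
    rw [add_sub_add_right_eq_sub] at this
    refine this.trans ?_
    rw [pow_two, ← mul_assoc]
    rw [add_sub_add_right_eq_sub] at hyx'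
    exact mul_le_mul_of_nonneg_left hyx' (by positivity)
  have e2' : ∀ s ∈ Ioc 0 t, ‖u (y + s • ν) - u (y + t • ν) - A ((s - t) • ν)‖ ≤ 2 * B * t ^ 2 := by
    rintro s ⟨hs, hst⟩
    have := norm_sub_sub_le_of_segment hΩ hu (hseg2 s hs hst) (C := 2 * B * t) (A := A) (by
      intro z hz
      obtain ⟨τ, h1, h2, rfl⟩ := segment_vertical hs hst hz
      exact hd2 τ (hs.trans_le h1) h2)
    rw [add_sub_add_left_eq_sub, ← sub_smul] at this
    refine this.trans ?_
    rw [pow_two, ← mul_assoc]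
    refine mul_le_mul_of_nonneg_left ?_ (by positivity)
    rw [norm_smul, hν, mul_one, Real.norm_eq_abs, abs_le]
    constructor <;> linarith
  have e2 : ‖u y - u (y + t • ν) - A ((0 - t) • ν)‖ ≤ 2 * B * t ^ 2 := by
    have hne : (nhdsWithin (0 : ℝ) (Ioc 0 t)).NeBot := by
      rw [← mem_closure_iff_nhdsWithin_neBot, closure_Ioc ht.ne]
      exact ⟨le_rfl, ht.le⟩
    have hlim1 : Filter.Tendsto (fun s : ℝ => u (y + s • ν)) (nhdsWithin 0 (Ioc 0 t))
        (nhds (u y)) := by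
      refine Filter.Tendsto.comp (huc y hy) (tendsto_nhdsWithin_iff.2 ⟨?_, ?_⟩)
      · have : Filter.Tendsto (fun s : ℝ => y + s • ν) (nhds 0) (nhds (y + (0 : ℝ) • ν)) :=
          (by fun_prop : Continuous fun s : ℝ => y + s • ν).tendsto 0
        rw [zero_smul, add_zero] at this
        exact this.mono_left nhdsWithin_le_nhds
      · filter_upwards [self_mem_nhdsWithin] with s hs
        exact subset_closure (hvert s hs.1 hs.2)
    have hlim2 : Filter.Tendsto (fun s : ℝ => A ((s - t) • ν)) (nhdsWithin 0 (Ioc 0 t))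
        (nhds (A ((0 - t) • ν))) :=
      ((by fun_prop : Continuous fun s : ℝ => A ((s - t) • ν)).tendsto 0).mono_left
        nhdsWithin_le_nhds
    refine le_of_tendsto ((hlim1.sub_const _).sub hlim2).norm ?_
    filter_upwards [self_mem_nhdsWithin] with s hs
    exact e2' s hs
  have hdecomp : u y - (u (x + t • ν) + A (y - (x + t • ν))) =
      (u (y + t • ν) - u (x + t • ν) - A (y - x)) +
        (u y - u (y + t • ν) - A ((0 - t) • ν)) := by
    have : y - (x + t • ν) = (y - x) + (0 - t) • ν := by module
    rw [this, map_add]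
    abel
  rw [hdecomp]
  refine (norm_add_le _ _).trans ?_
  linarith

/-- A field of class `C²` is differentiable relative to the closure at every point of it, and its
derivative is close to those at the points of the axis of the cone. -/
theorem exists_hasFDerivWithinAt_closure (hΩ : IsOpen Ω) (hu : ContDiffOn ℝ 2 u Ω)
    (huc : ContinuousOn u (closure Ω)) (hB : ∀ x ∈ Ω, ‖iteratedFDeriv ℝ 2 u x‖ ≤ B) {r θ : ℝ}
    (hr : 0 < r) (hθ : 0 < θ) (hθ1 : θ ≤ 1) {x ν : Vec d} (hx : x ∈ closure Ω) (hν : ‖ν‖ = 1)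
    (hcone : ∀ y ∈ closure Ω, dist y x ≤ r → ∀ t, 0 < t → t ≤ r → ∀ w, ‖w‖ ≤ θ * t →
      y + t • ν + w ∈ Ω) :
    ∃ L : Vec d →L[ℝ] Vec d, HasFDerivWithinAt u L (closure Ω) x ∧
      ∀ t, 0 < t → t ≤ r → ‖L - fderiv ℝ u (x + t • ν)‖ ≤ B * t := by
  have hvert : ∀ τ, 0 < τ → τ ≤ r → x + τ • ν ∈ Ω := fun τ h0 h1 => by
    have := hcone x hx (by simpa using hr.le) τ h0 h1 0 (by rw [norm_zero]; positivity)
    simpa using this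
  have hB0 : 0 ≤ B := (norm_nonneg _).trans (hB _ (hvert r hr le_rfl))
  have hDu : ∀ s t, 0 < s → s ≤ t → t ≤ r →
      ‖fderiv ℝ u (x + s • ν) - fderiv ℝ u (x + t • ν)‖ ≤ B * t := by
    intro s t hs hst htr
    refine (norm_fderiv_sub_le_of_segment hΩ hu hB fun z hz => ?_).trans ?_
    · obtain ⟨τ, h1, h2, rfl⟩ := segment_vertical hs hst hz
      exact hvert τ (hs.trans_le h1) (h2.trans htr)
    · refine mul_le_mul_of_nonneg_left ?_ hB0
      rw [add_sub_add_left_eq_sub, ← sub_smul, norm_smul, hν, mul_one, Real.norm_eq_abs, abs_le]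
      constructor <;> linarith
  set τ : ℕ → ℝ := fun k => r * (1 / ((k : ℝ) + 1)) with hτ
  have hτ0 : ∀ k, 0 < τ k := fun k => by positivity
  have hτlim : Filter.Tendsto τ Filter.atTop (nhds 0) := by
    have := tendsto_one_div_add_atTop_nhds_zero_nat (𝕜 := ℝ).const_mul r
    simpa [hτ] using this
  have hτanti : ∀ k l, k ≤ l → τ l ≤ τ k := fun k l h => by
    simp only [hτ]
    gcongr
  have hτr : ∀ k, τ k ≤ r := fun k => (hτanti 0 k (Nat.zero_le k)).trans (by simp [hτ])
  have hcauchy : CauchySeq fun k => fderiv ℝ u (x + τ k • ν) := by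
    refine cauchySeq_of_le_tendsto_0' (fun k => B * τ k) (fun k l hkl => ?_) (by
      simpa using hτlim.const_mul B)
    rw [dist_comm, dist_eq_norm]
    exact hDu _ _ (hτ0 l) (hτanti k l hkl) (hτr k)
  obtain ⟨L, hL⟩ := cauchySeq_tendsto_of_complete hcauchy
  have hLt : ∀ t, 0 < t → t ≤ r → ‖L - fderiv ℝ u (x + t • ν)‖ ≤ B * t := by
    intro t ht htr
    refine le_of_tendsto (hL.sub_const _).norm ?_
    filter_upwards [hτlim.eventually (gt_mem_nhds ht)] with k hk
    exact hDu _ _ (hτ0 k) hk.le htr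
  refine ⟨L, ?_, hLt⟩
  -- compare both `u y` and `u x` with the Taylor polynomial at height `t = ‖y - x‖ / θ`
  have hO : (fun y => u y - u x - L (y - x)) =O[nhdsWithin x (closure Ω)]
      fun y => ‖y - x‖ ^ 2 := by
    refine Asymptotics.IsBigO.of_bound (7 * B / θ ^ 2) ?_
    filter_upwards [self_mem_nhdsWithin, mem_nhdsWithin_of_mem_nhds
      (Metric.ball_mem_nhds x (mul_pos hθ hr))] with y hy hyball
    rcases eq_or_ne y x with rfl | hne
    · simp
    · set t := ‖y - x‖ / θ with ht
      have ht0 : 0 < t := div_pos (norm_pos_iff.2 (sub_ne_zero.2 hne)) hθ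
      have hyt : ‖y - x‖ = θ * t := by rw [ht]; field_simp
      have htr : t ≤ r := by
        rw [Metric.mem_ball, dist_eq_norm, hyt] at hyball
        exact (lt_of_mul_lt_mul_left hyball hθ.le).le
      have h1 := norm_sub_taylor_le hΩ hu huc hB hθ1 hx hν hcone ht0 htr hy
        (by rw [dist_eq_norm, hyt])
      have h2 := norm_sub_taylor_le hΩ hu huc hB hθ1 hx hν hcone ht0 htr hx
        (by rw [dist_self]; positivity)
      have h3 := hLt t ht0 htr
      set A := fderiv ℝ u (x + t • ν)
      have h4 : u y - u x - L (y - x) = (u y - (u (x + t • ν) + A (y - (x + t • ν)))) -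
          (u x - (u (x + t • ν) + A (x - (x + t • ν)))) - (L - A) (y - x) := by
        have : y - (x + t • ν) = (y - x) + (x - (x + t • ν)) := by abel
        rw [this, map_add, sub_apply]
        abel
      have h5 : ‖(L - A) (y - x)‖ ≤ B * t * t := by
        refine ((L - A).le_opNorm _).trans ?_
        have : ‖y - x‖ ≤ t := by rw [hyt]; nlinarith
        exact mul_le_mul h3 this (norm_nonneg _) (by positivity)
      have h6 := norm_sub_le ((u y - (u (x + t • ν) + A (y - (x + t • ν)))) -
          (u x - (u (x + t • ν) + A (x - (x + t • ν))))) ((L - A) (y - x))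
      have h7 := norm_sub_le (u y - (u (x + t • ν) + A (y - (x + t • ν))))
          (u x - (u (x + t • ν) + A (x - (x + t • ν))))
      rw [h4, norm_pow, norm_norm, hyt]
      have h8 : 7 * B / θ ^ 2 * (θ * t) ^ 2 = 7 * B * t ^ 2 := by field_simp
      rw [h8]
      nlinarith
  have h0 := Asymptotics.IsBigO.hasFDerivWithinAt (𝕜 := ℝ) hO hx (by norm_num)
  have h1 := (h0.add (L.hasFDerivWithinAt (s := closure Ω) (x := x))).add_const (u x - L x)
  rw [zero_add] at h1
  refine h1.congr_of_eventuallyEq (Filter.Eventually.of_forall fun y => ?_) ?_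
  · simp only [Pi.add_apply, map_sub]
    abel
  · simp

end

theorem IsC2.iteratedFDeriv_le_c2Norm {d : ℕ} {Ω : Set (Vec d)} {u : Vec d → Vec d}
    (hu : IsC2 Ω u) {x : Vec d} (hx : x ∈ Ω) : ‖iteratedFDeriv ℝ 2 u x‖ ≤ c2Norm Ω u := by
  have h1 : ‖iteratedFDeriv ℝ 2 u x‖ ≤ sSup ((fun x => ‖iteratedFDeriv ℝ 2 u x‖) '' Ω) :=
    le_csSup (hu.bddAbove 2 le_rfl) ⟨x, hx, rfl⟩
  refine h1.trans (Finset.single_le_sum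
    (f := fun k => sSup ((fun x => ‖iteratedFDeriv ℝ k u x‖) '' Ω)) (fun k _ => ?_)
    (by simp : 2 ∈ Finset.range 3))
  refine Real.sSup_nonneg ?_
  rintro _ ⟨y, -, rfl⟩
  exact norm_nonneg _

theorem c2Norm_nonneg {d : ℕ} (Ω : Set (Vec d)) (u : Vec d → Vec d) : 0 ≤ c2Norm Ω u := by
  refine Finset.sum_nonneg fun k _ => Real.sSup_nonneg ?_
  rintro _ ⟨y, -, rfl⟩
  exact norm_nonneg _

/-- First-order Taylor approximation at the scale `t` near any point `x` of the closure. -/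
theorem IsC2.exists_affine_approx {d : ℕ} {Ω : Set (Vec d)} {u : Vec d → Vec d}
    (hu : IsC2 Ω u) (hΩ : IsOpen Ω) {r θ : ℝ} (hcone : UniformCone Ω r θ) (hr : 0 < r)
    (hθ : 0 < θ) (hθ1 : θ ≤ 1) {x : Vec d} (hx : x ∈ closure Ω) {t : ℝ} (ht : 0 < t)
    (htr : t ≤ r) :
    ∃ T : Vec d →ᵃ[ℝ] Vec d,
      (∀ y ∈ closure Ω, dist y x ≤ θ * t → ‖u y - T y‖ ≤ 3 * c2Norm Ω u * t ^ 2) ∧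
      |divergence Ω u x - affineDiv T| ≤ d * (c2Norm Ω u * t) := by
  obtain ⟨ν, hν, hc⟩ := hcone x hx
  have hB := fun x (hx : x ∈ Ω) => hu.iteratedFDeriv_le_c2Norm hx
  obtain ⟨L, hL, hLt⟩ := exists_hasFDerivWithinAt_closure hΩ hu.contDiffOn hu.continuousOn hB
    hr hθ hθ1 hx hν hc
  set A := fderiv ℝ u (x + t • ν) with hA
  refine ⟨A.toLinearMap.toAffineMap +
    AffineMap.const ℝ (Vec d) (u (x + t • ν) - A (x + t • ν)), fun y hy hyx => ?_, ?_⟩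
  · have := norm_sub_taylor_le hΩ hu.contDiffOn hu.continuousOn hB hθ1 hx hν hc ht htr hy hyx
    rw [map_sub] at this
    convert this using 3
    change A y + (u (x + t • ν) - A (x + t • ν)) = u (x + t • ν) + (A y - A (x + t • ν))
    abel
  · rw [divergence, hL.fderivWithin (hcone.uniqueDiffWithinAt hr hθ hx), affineDiv,
      ← Finset.sum_sub_distrib]
    refine (Finset.abs_sum_le_sum_abs _ _).trans ?_
    have : ∀ k ∈ (Finset.univ : Finset (Fin d)), |L (EuclideanSpace.single k 1) k -
        (A.toLinearMap.toAffineMap + AffineMap.const ℝ (Vec d)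
          (u (x + t • ν) - A (x + t • ν))).linear (EuclideanSpace.single k 1) k| ≤
        c2Norm Ω u * t := by
      intro k _
      have h1 : L (EuclideanSpace.single k 1) k - (A.toLinearMap.toAffineMap +
          AffineMap.const ℝ (Vec d) (u (x + t • ν) - A (x + t • ν))).linear
          (EuclideanSpace.single k 1) k = ((L - A) (EuclideanSpace.single k 1)) k := by
        simp
      rw [h1, ← Real.norm_eq_abs]
      refine (PiLp.norm_apply_le _ k).trans (((L - A).le_opNorm _).trans ?_)
      simpa using hLt t ht htr
    refine (Finset.sum_le_sum this).trans ?_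
    simp

/-! ### Quasi-uniform point clouds -/

/-- An affine field that is bounded by `δ` at perturbations by at most `h` of the vertices
`c, c + 4 d h e_1, …, c + 4 d h e_d` of a simplex grows at most like `δ / h`. -/
theorem norm_affine_le_of_simplex {d : ℕ} (hd : 0 < d) (p : Vec d →ᵃ[ℝ] Vec d) {c y₀ : Vec d}
    {y : Fin d → Vec d} {h δ : ℝ} (hh : 0 < h) (h0 : dist y₀ c ≤ h)
    (h1 : ∀ k, dist (y k) (c + (4 * d * h) • EuclideanSpace.single k (1 : ℝ)) ≤ h)
    (hp0 : ‖p y₀‖ ≤ δ) (hp : ∀ k, ‖p (y k)‖ ≤ δ) (x : Vec d) :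
    ‖p x‖ ≤ δ * (1 + dist x y₀ / h) := by
  have hd' : (0 : ℝ) < d := by exact_mod_cast hd
  set A : Vec d →L[ℝ] Vec d := LinearMap.toContinuousLinearMap p.linear with hA
  have hAp : ∀ a b, A (a - b) = p a - p b := fun a b => p.linearMap_vsub a b
  have hk : ∀ k, 4 * d * h * ‖A (EuclideanSpace.single k 1)‖ ≤ 2 * δ + 2 * h * ‖A‖ := by
    intro k
    have e1 : A ((4 * d * h) • EuclideanSpace.single k (1 : ℝ)) = (p (y k) - p y₀) +
        (A (y₀ - c) - A (y k - (c + (4 * d * h) • EuclideanSpace.single k (1 : ℝ)))) := by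
      rw [← hAp, ← map_sub, ← map_add]
      congr 1
      abel
    have e2 : 4 * d * h * ‖A (EuclideanSpace.single k 1)‖ =
        ‖A ((4 * d * h) • EuclideanSpace.single k (1 : ℝ))‖ := by
      rw [map_smul, norm_smul, Real.norm_of_nonneg (by positivity)]
    rw [e2, e1]
    have e3 : ‖A (y₀ - c)‖ ≤ ‖A‖ * h :=
      (A.le_opNorm _).trans (mul_le_mul_of_nonneg_left (by rwa [← dist_eq_norm]) (norm_nonneg _))
    have e4 : ‖A (y k - (c + (4 * d * h) • EuclideanSpace.single k (1 : ℝ)))‖ ≤ ‖A‖ * h :=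
      (A.le_opNorm _).trans
        (mul_le_mul_of_nonneg_left (by rw [← dist_eq_norm]; exact h1 k) (norm_nonneg _))
    have e5 := norm_add_le (p (y k) - p y₀)
      (A (y₀ - c) - A (y k - (c + (4 * d * h) • EuclideanSpace.single k (1 : ℝ))))
    have e6 := norm_sub_le (p (y k)) (p y₀)
    have e7 := norm_sub_le (A (y₀ - c))
      (A (y k - (c + (4 * d * h) • EuclideanSpace.single k (1 : ℝ))))
    have := hp k
    linarith
  have hop : ‖A‖ ≤ ∑ k, ‖A (EuclideanSpace.single k 1)‖ := by
    refine A.opNorm_le_bound (Finset.sum_nonneg fun k _ => norm_nonneg _) fun v => ?_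
    have hv : v = ∑ k, v k • EuclideanSpace.single k (1 : ℝ) := by
      ext j
      simp [Finset.sum_apply, Pi.single_apply]
    conv_lhs => rw [hv]
    rw [map_sum, Finset.sum_mul]
    refine (norm_sum_le _ _).trans (Finset.sum_le_sum fun k _ => ?_)
    rw [map_smul, norm_smul, mul_comm]
    exact mul_le_mul_of_nonneg_left (PiLp.norm_apply_le v k) (norm_nonneg _)
  have hAδ : ‖A‖ * h ≤ δ := by
    have h2 : 4 * d * h * ‖A‖ ≤ d * (2 * δ + 2 * h * ‖A‖) := by
      calc 4 * d * h * ‖A‖ ≤ 4 * d * h * ∑ k, ‖A (EuclideanSpace.single k 1)‖ := by gcongr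
        _ = ∑ k, 4 * d * h * ‖A (EuclideanSpace.single k 1)‖ := Finset.mul_sum _ _ _
        _ ≤ ∑ k : Fin d, (2 * δ + 2 * h * ‖A‖) := Finset.sum_le_sum fun k _ => hk k
        _ = d * (2 * δ + 2 * h * ‖A‖) := by simp; ring
    have h3 : d * (4 * h * ‖A‖) ≤ d * (2 * δ + 2 * h * ‖A‖) := by linarith
    have h4 := le_of_mul_le_mul_left h3 hd'
    linarith
  have hx : p x = p y₀ + A (x - y₀) := by rw [hAp]; abel
  have h5 : ‖A (x - y₀)‖ ≤ ‖A‖ * dist x y₀ := by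
    rw [dist_eq_norm]; exact A.le_opNorm _
  have h6 : ‖A‖ ≤ δ / h := by rwa [le_div_iff₀ hh]
  calc ‖p x‖ ≤ ‖p y₀‖ + ‖A (x - y₀)‖ := by rw [hx]; exact norm_add_le _ _
    _ ≤ δ + δ / h * dist x y₀ :=
        add_le_add hp0 (h5.trans (mul_le_mul_of_nonneg_right h6 dist_nonneg))
    _ = δ * (1 + dist x y₀ / h) := by ring

theorem kernel_nonneg (ε ρ : ℝ) : 0 ≤ kernel ε ρ := by
  unfold kernel; positivity

theorem kernel_le_one {ε ρ : ℝ} (hε : 0 < ε) (hρ : 0 ≤ ρ) : kernel ε ρ ≤ 1 := by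
  unfold kernel
  refine pow_le_one₀ (le_max_right _ _) (max_le ?_ zero_le_one)
  have : 0 ≤ ρ / ε := by positivity
  linarith

theorem le_kernel {ε ρ : ℝ} (hε : 0 < ε) (hρ : ρ ≤ ε / 2) : 1 / 16 ≤ kernel ε ρ := by
  unfold kernel
  have h1 : (1 : ℝ) / 2 ≤ 1 - ρ / ε := by
    have : ρ / ε ≤ 1 / 2 := by rw [div_le_iff₀ hε]; linarith
    linarith
  calc (1 : ℝ) / 16 = (1 / 2) ^ 4 := by norm_num
    _ ≤ _ := pow_le_pow_left₀ (by norm_num) (h1.trans (le_max_left _ _)) 4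

theorem kernel_eq_zero {ε ρ : ℝ} (hε : 0 < ε) (hρ : ε ≤ ρ) : kernel ε ρ = 0 := by
  unfold kernel
  have : 1 - ρ / ε ≤ 0 := by
    have : 1 ≤ ρ / ε := by rwa [le_div_iff₀ hε, one_mul]
    linarith
  rw [max_eq_right this]
  norm_num

theorem centroid_mem_closedBall {d : ℕ} {F : Set (Vec d)} (hF : IsClosed F)
    (hpos : 0 < (μHE[d - 1] : Measure (Vec d)) F) (hfin : (μHE[d - 1] : Measure (Vec d)) F < ⊤)
    {c : Vec d} {ρ : ℝ} (hFc : F ⊆ Metric.closedBall c ρ) : centroid F ∈ Metric.closedBall c ρ := by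
  have hcomp : IsCompact F := Metric.isCompact_of_isClosed_isBounded hF
    (Metric.isBounded_closedBall.subset hFc)
  have := (convex_closedBall c ρ).set_average_mem (f := fun x : Vec d => x)
    Metric.isClosed_closedBall hpos.ne' hfin.ne
    (ae_restrict_of_forall_mem hF.measurableSet hFc)
    (integrableOn_of_continuousOn_compact hcomp hfin continuousOn_id)
  rwa [setAverage_eq] at this

namespace DualMesh

section
variable {m N : ℕ} {Ω : Set (Vec (m + 1))} (M : DualMesh Ω N)

theorem nonempty_index (M : DualMesh Ω N) (hΩ : IsLipschitzDomain Ω) : Nonempty (Fin N) := by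
  by_contra h
  rw [not_nonempty_iff] at h
  have h1 := M.cell_cover
  rw [iUnion_of_empty] at h1
  exact hΩ.isConnected.nonempty.closure.ne_empty h1.symm

theorem iInf_dist_le_fillDist (hΩ : IsLipschitzDomain Ω) {x : Vec (m + 1)} (hx : x ∈ Ω) :
    ⨅ i, dist x (M.pt i) ≤ M.fillDist := by
  have hne := M.nonempty_index hΩ
  obtain ⟨i₀⟩ := hne
  refine le_ciSup (f := fun x : Ω => ⨅ i, dist (x : Vec (m + 1)) (M.pt i)) ?_ ⟨x, hx⟩
  refine ⟨Metric.diam (closure Ω), ?_⟩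
  rintro _ ⟨y, rfl⟩
  refine (ciInf_le ⟨0, ?_⟩ i₀).trans (Metric.dist_le_diam_of_mem hΩ.isBounded.closure
    (subset_closure y.2) (M.pt_mem_closure i₀))
  rintro _ ⟨i, rfl⟩
  exact dist_nonneg

theorem exists_dist_le_fillDist (hΩ : IsLipschitzDomain Ω) {x : Vec (m + 1)} (hx : x ∈ Ω) :
    ∃ i, dist x (M.pt i) ≤ M.fillDist := by
  have hne := M.nonempty_index hΩ
  obtain ⟨i, hi⟩ := exists_eq_ciInf_of_finite (f := fun i => dist x (M.pt i))
  exact ⟨i, hi.le.trans (M.iInf_dist_le_fillDist hΩ hx)⟩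

/-- The fill distance is positive, since an open set is not contained in a finite set. -/
theorem fillDist_pos (hΩ : IsLipschitzDomain Ω) : 0 < M.fillDist := by
  by_contra! hcon
  have hsub : Ω ⊆ range M.pt := by
    intro x hx
    obtain ⟨i, hi⟩ := M.exists_dist_le_fillDist hΩ hx
    exact ⟨i, (dist_le_zero.1 (hi.trans hcon)).symm⟩
  have h1 : volume Ω = 0 := ((finite_range M.pt).subset hsub).measure_zero _
  exact (hΩ.isOpen.measure_pos volume hΩ.isConnected.nonempty).ne' h1

theorem two_mul_sepDist_le {i j : Fin N} (hij : i ≠ j) :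
    2 * M.sepDist ≤ dist (M.pt i) (M.pt j) := by
  have : ⨅ p : {p : Fin N × Fin N // p.1 ≠ p.2}, dist (M.pt p.1.1) (M.pt p.1.2) ≤
      dist (M.pt i) (M.pt j) :=
    ciInf_le (f := fun p : {p : Fin N × Fin N // p.1 ≠ p.2} => dist (M.pt p.1.1) (M.pt p.1.2))
      ⟨0, by rintro _ ⟨p, rfl⟩; exact dist_nonneg⟩ ⟨(i, j), hij⟩
  rw [sepDist]
  linarith

theorem sepDist_nonneg : 0 ≤ M.sepDist :=
  div_nonneg (Real.iInf_nonneg fun _ => dist_nonneg) two_pos.le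

theorem QuasiUniform.sepDist_pos {M : DualMesh Ω N} (hΩ : IsLipschitzDomain Ω) {c : ℝ}
    (hM : M.QuasiUniform c) : 0 < M.sepDist := by
  refine lt_of_le_of_ne M.sepDist_nonneg fun h => ?_
  have := hM.2
  rw [← h, mul_zero] at this
  exact absurd (M.fillDist_pos hΩ) (not_lt.2 this)

theorem QuasiUniform.const_pos {M : DualMesh Ω N} (hΩ : IsLipschitzDomain Ω) {c : ℝ}
    (hM : M.QuasiUniform c) : 0 < c :=
  pos_of_mul_pos_left ((M.fillDist_pos hΩ).trans_le hM.2) M.sepDist_nonneg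

/-- The number of points of a quasi-uniform cloud in a ball of radius `O(h)` is bounded. -/
theorem QuasiUniform.card_le {M : DualMesh Ω N} (hΩ : IsLipschitzDomain Ω) {c : ℝ}
    (hM : M.QuasiUniform c) {κ : ℝ} (hκ : 0 ≤ κ) (x : Vec (m + 1)) (s : Finset (Fin N))
    (hs : ∀ i ∈ s, dist (M.pt i) x ≤ κ * M.fillDist) : (s.card : ℝ) ≤ (κ * c + 1) ^ (m + 1) := by
  set q := M.sepDist with hq
  have hq0 : 0 < q := hM.sepDist_pos hΩ
  have hc : 0 < c := hM.const_pos hΩ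
  set v := volume (Metric.ball (0 : Vec (m + 1)) 1) with hv
  have hsub : ⋃ i ∈ s, Metric.ball (M.pt i) q ⊆ Metric.ball x ((κ * c + 1) * q) := by
    refine iUnion₂_subset fun i hi y hy => ?_
    have h1 := hs i hi
    have h2 := dist_triangle y (M.pt i) x
    rw [Metric.mem_ball] at hy ⊢
    have h3 : κ * M.fillDist ≤ κ * (c * q) := mul_le_mul_of_nonneg_left hM.2 hκ
    linarith
  have hmeas : volume (⋃ i ∈ s, Metric.ball (M.pt i) q) =
      ∑ i ∈ s, volume (Metric.ball (M.pt i) q) := by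
    refine measure_biUnion_finset (fun i _ j _ hij => ?_) fun i _ => measurableSet_ball
    refine Metric.ball_disjoint_ball ?_
    have := M.two_mul_sepDist_le hij
    linarith
  have h1 := measure_mono (μ := volume) hsub
  rw [hmeas] at h1
  have hball : ∀ i ∈ s, volume (Metric.ball (M.pt i) q) = ENNReal.ofReal (q ^ (m + 1)) * v :=
    fun i _ => by
      rw [Measure.addHaar_ball _ _ hq0.le, finrank_euclideanSpace_fin]
  rw [Finset.sum_congr rfl hball, Finset.sum_const, nsmul_eq_mul,
    Measure.addHaar_ball _ x (by positivity), finrank_euclideanSpace_fin, mul_pow,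
    ENNReal.ofReal_mul (by positivity), ← mul_assoc] at h1
  have hv0 : v ≠ 0 := (Metric.measure_ball_pos volume _ one_pos).ne'
  have hvt : v ≠ ⊤ := measure_ball_lt_top.ne
  have h2 := (ENNReal.mul_le_mul_iff_left hv0 hvt).1 h1
  have h3 := (ENNReal.mul_le_mul_iff_left (by positivity) ENNReal.ofReal_ne_top).1 h2
  rw [← ENNReal.ofReal_natCast] at h3
  exact (ENNReal.ofReal_le_ofReal_iff (by positivity)).1 h3

/-- Near every point of the closure there are interior points of the cloud at the scale of the fill
distance `h`, at prescribed offsets from the axis of the cone. -/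
theorem exists_interior_pt (hΩ : IsLipschitzDomain Ω) {r θ : ℝ} {x ν : Vec (m + 1)}
    (hx : x ∈ closure Ω)
    (hcone : ∀ y ∈ closure Ω, dist y x ≤ r → ∀ t, 0 < t → t ≤ r → ∀ w, ‖w‖ ≤ θ * t →
      y + t • ν + w ∈ Ω) {t : ℝ} (ht : 0 < t) (htr : t ≤ r) {v : Vec (m + 1)}
    (hv : ‖v‖ + M.fillDist ≤ θ * t) :
    ∃ i, i ∉ M.bdry ∧ dist (M.pt i) (x + t • ν + v) ≤ M.fillDist := by
  have hxr : dist x x ≤ r := by simpa using ht.le.trans htr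
  have hmem : x + t • ν + v ∈ Ω := hcone x hx hxr t ht htr v
    (by linarith [M.fillDist_pos hΩ])
  obtain ⟨i, hi⟩ := M.exists_dist_le_fillDist hΩ hmem
  refine ⟨i, fun hb => ?_, by rwa [dist_comm]⟩
  have h1 : M.pt i ∈ Ω := by
    have h2 : M.pt i = x + t • ν + (v + (M.pt i - (x + t • ν + v))) := by abel
    rw [h2]
    refine hcone x hx hxr t ht htr _ ((norm_add_le _ _).trans ?_)
    rw [← dist_eq_norm, dist_comm]
    linarith
  have h3 := M.pt_bdry i hb
  rw [hΩ.isOpen.frontier_eq] at h3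
  exact h3.2 h1

/-- Quantitative unisolvency: an affine field is controlled by its values at the interior points of
the cloud near a point of the closure. The constants `4 d h` and `8 d h` give room for a simplex of
interior points in the ball about `x + t ν` that is provided by the cone property. -/
theorem exists_affine_bound (hΩ : IsLipschitzDomain Ω) {r θ : ℝ} (hθ : 0 < θ)
    (hcone : UniformCone Ω r θ) {x : Vec (m + 1)}
    (hx : x ∈ closure Ω) (htr : 8 * (m + 1) / θ * M.fillDist ≤ r) {ρ : ℝ}
    (hρ : (8 * (m + 1) / θ + 4 * (m + 1) + 1) * M.fillDist ≤ ρ) :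
    ∃ y₀, dist y₀ x ≤ ρ ∧ ∀ (p : Vec (m + 1) →ᵃ[ℝ] Vec (m + 1)) (δ : ℝ),
      (∀ j, j ∉ M.bdry → dist (M.pt j) x ≤ ρ → ‖p (M.pt j)‖ ≤ δ) →
      ∀ y, ‖p y‖ ≤ δ * (1 + dist y y₀ / M.fillDist) := by
  have hh := M.fillDist_pos hΩ
  set h := M.fillDist with hdef
  obtain ⟨ν, hν, hc⟩ := hcone x hx
  set t := 8 * (m + 1) / θ * h with ht
  have ht0 : 0 < t := by positivity
  have hθt : θ * t = 8 * (m + 1) * h := by rw [ht]; field_simp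
  have hm : (0 : ℝ) ≤ m := Nat.cast_nonneg m
  have key : ∀ v : Vec (m + 1), ‖v‖ ≤ 4 * (m + 1) * h →
      ∃ i, i ∉ M.bdry ∧ dist (M.pt i) (x + t • ν + v) ≤ h ∧ dist (M.pt i) x ≤ ρ := by
    intro v hv
    obtain ⟨i, hi, hd⟩ := M.exists_interior_pt hΩ hx hc ht0 htr (v := v) (by
      rw [hθt]; nlinarith)
    refine ⟨i, hi, hd, (dist_triangle _ (x + t • ν + v) _).trans (le_trans ?_ hρ)⟩
    have h1 : dist (x + t • ν + v) x ≤ t + 4 * (m + 1) * h := by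
      rw [dist_eq_norm, add_assoc, add_sub_cancel_left]
      refine (norm_add_le _ _).trans (add_le_add ?_ hv)
      rw [norm_smul, hν, Real.norm_of_nonneg ht0.le, mul_one]
    calc _ ≤ h + (t + 4 * (m + 1) * h) := add_le_add hd h1
      _ = _ := by rw [ht]; ring
  obtain ⟨i₀, hi₀, hd₀, hρ₀⟩ := key 0 (by rw [norm_zero]; positivity)
  have hk : ∀ k : Fin (m + 1), ∃ i, i ∉ M.bdry ∧
      dist (M.pt i) (x + t • ν + (4 * (m + 1) * h) • EuclideanSpace.single k (1 : ℝ)) ≤ h ∧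
      dist (M.pt i) x ≤ ρ := fun k => key _ (by
    rw [norm_smul, Real.norm_of_nonneg (by positivity)]; simp)
  choose i hi hdi hρi using hk
  refine ⟨M.pt i₀, hρ₀, fun p δ hp y => ?_⟩
  refine norm_affine_le_of_simplex (Nat.succ_pos m) p (c := x + t • ν) (y := fun k => M.pt (i k))
    hh (by simpa using hd₀) (fun k => ?_) (hp i₀ hi₀ hρ₀) (fun k => hp _ (hi k) (hρi k)) y
  push_cast
  exact hdi k

theorem face_measure_lt_top (hΩ : Bornology.IsBounded Ω) {i j : Fin N} (hj : j ∈ M.nbr i) :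
    (μHE[m] : Measure (Vec (m + 1))) (M.face i j) < ⊤ := by
  obtain ⟨b, hb⟩ := M.face_affine i j hj
  exact euclideanHausdorffMeasure_flat_lt_top (M.norm_normal hj) hb
    (M.isCompact_face hΩ i j).isBounded

theorem bdryFace_measure_lt_top (hΩ : Bornology.IsBounded Ω) {i : Fin N} (hi : i ∈ M.bdry) :
    (μHE[m] : Measure (Vec (m + 1))) (M.bdryFace i) < ⊤ := by
  obtain ⟨b, hb⟩ := M.bdryFace_affine i hi
  exact euclideanHausdorffMeasure_flat_lt_top (M.norm_bdryNormal hi) hb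
    (M.isCompact_bdryFace hΩ i).isBounded

theorem cell_subset_closedBall (hΩ : Bornology.IsBounded Ω) {c : ℝ} (hM : M.ShapeRegular c)
    {D : ℝ} (hD : c * M.fillDist ≤ D) (i : Fin N) :
    M.cell i ⊆ Metric.closedBall (M.pt i) D := fun _ hy =>
  (Metric.dist_le_diam_of_mem (M.isCompact_cell hΩ i).isBounded hy (M.pt_mem_cell i)).trans
    ((hM i).1.trans hD)

/-- The anchors of the least squares problems of the faces of `ω_i` lie within `O(h)` of `x_i`. -/
theorem centroid_face_mem (hΩ : Bornology.IsBounded Ω) {c : ℝ} (hM : M.ShapeRegular c)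
    {D : ℝ} (hD : c * M.fillDist ≤ D) {i j : Fin N} (hj : j ∈ M.nbr i) :
    centroid (M.face i j) ∈ Metric.closedBall (M.pt i) D :=
  centroid_mem_closedBall (M.isClosed_face i j) (M.face_pos i j hj) (M.face_measure_lt_top hΩ hj)
    ((M.face_subset_cell i j).trans (M.cell_subset_closedBall hΩ hM hD i))

theorem centroid_bdryFace_mem (hΩ : Bornology.IsBounded Ω) {c : ℝ} (hM : M.ShapeRegular c)
    {D : ℝ} (hD : c * M.fillDist ≤ D) {i : Fin N} (hi : i ∈ M.bdry) :
    centroid (M.bdryFace i) ∈ Metric.closedBall (M.pt i) D :=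
  centroid_mem_closedBall (M.isClosed_bdryFace i) (M.bdryFace_pos i hi)
    (M.bdryFace_measure_lt_top hΩ hi)
    ((M.bdryFace_subset_cell i).trans (M.cell_subset_closedBall hΩ hM hD i))

theorem exists_dist_anchor_le (hΩ : Bornology.IsBounded Ω) {c : ℝ} (hM : M.ShapeRegular c)
    {D : ℝ} (hD : c * M.fillDist ≤ D) {γ : Finset (Fin N)} {z : Vec (m + 1)}
    (hz : z ∈ M.anchors γ) : ∃ i, dist z (M.pt i) ≤ D := by
  rcases hz with ⟨i, j, hj, rfl⟩ | ⟨i, hi, rfl⟩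
  · exact ⟨i, M.centroid_face_mem hΩ hM hD hj⟩
  · exact ⟨i, M.centroid_bdryFace_mem hΩ hM hD (Finset.mem_sdiff.1 hi).1⟩

end

end DualMesh

/-! ### Generalized moving least squares -/

theorem affineMap_sum_apply {ι V W : Type*} [AddCommGroup V] [Module ℝ V] [AddCommGroup W]
    [Module ℝ W] (s : Finset ι) (f : ι → V →ᵃ[ℝ] W) (x : V) :
    (∑ i ∈ s, f i) x = ∑ i ∈ s, f i x := by
  classical
  induction s using Finset.induction_on with
  | empty => simp
  | insert a s ha ih => rw [Finset.sum_insert ha, Finset.sum_insert ha, ← ih]; rfl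

/-- The affine field with coefficients `b` with respect to the basis `e_k φ_r` of `(P₁)^d`. -/
def P1Basis.field {d : ℕ} (φ : P1Basis d) (b : Fin d × Fin (d + 1) → ℝ) : Vec d →ᵃ[ℝ] Vec d :=
  ∑ s, b s • (LinearMap.toSpanSingleton ℝ (Vec d)
    (EuclideanSpace.single s.1 (1 : ℝ))).toAffineMap.comp (φ s.2)

theorem P1Basis.field_apply {d : ℕ} (φ : P1Basis d) (b : Fin d × Fin (d + 1) → ℝ) (x : Vec d) :
    φ.field b x = ∑ s, b s • φ.vec s x := by
  rw [field, affineMap_sum_apply]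
  rfl

theorem P1Basis.exists_field_eq {d : ℕ} (φ : P1Basis d) (T : Vec d →ᵃ[ℝ] Vec d) :
    ∃ b, φ.field b = T := by
  let g : Fin d → Vec d →ᵃ[ℝ] ℝ := fun k =>
    (EuclideanSpace.proj k : Vec d →L[ℝ] ℝ).toLinearMap.toAffineMap.comp T
  refine ⟨fun s => φ.repr (g s.1) s.2, ?_⟩
  ext x k
  have h1 : ∀ k, T x k = ∑ r, φ.repr (g k) r * φ r x := by
    intro k
    have h2 : g k x = (∑ r, φ.repr (g k) r • φ r) x := by rw [φ.sum_repr]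
    rw [affineMap_sum_apply] at h2
    exact h2
  rw [φ.field_apply, Fintype.sum_prod_type, h1 k]
  simp [P1Basis.vec, Pi.single_apply, Finset.sum_ite_eq]

/-- Linear least squares problems have solutions. -/
theorem exists_norm_sub_le_of_linearMap {V E : Type*} [AddCommGroup V] [Module ℝ V]
    [FiniteDimensional ℝ V] [NormedAddCommGroup E] [InnerProductSpace ℝ E] (L : V →ₗ[ℝ] E) (t : E) :
    ∃ c, ∀ b, ‖t - L c‖ ≤ ‖t - L b‖ := by
  obtain ⟨v, ⟨c, rfl⟩, hv⟩ := Submodule.exists_norm_eq_iInf_of_complete_subspace (LinearMap.range L)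
    (Submodule.complete_of_finiteDimensional _) t
  refine ⟨c, fun b => ?_⟩
  rw [hv]
  exact ciInf_le (f := fun w : LinearMap.range L => ‖t - w‖)
    ⟨0, by rintro _ ⟨_, rfl⟩; exact norm_nonneg _⟩ ⟨L b, b, rfl⟩

/-- A pointwise bound from a comparison of weighted sums of squares, at a point of weight at least
`1 / 16`. -/
theorem le_of_weighted_sum_sq_le {ι : Type*} [Fintype ι] (κ a b : ι → ℝ) {η n : ℝ}
    (hκ0 : ∀ i, 0 ≤ κ i) (hκ1 : ∀ i, κ i ≤ 1) (ha : ∀ i, 0 ≤ a i) (hb : ∀ i, 0 ≤ b i)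
    (hη : ∀ i, κ i ≠ 0 → b i ≤ η) (hn : 1 ≤ n)
    (hcard : ∀ s : Finset ι, (∀ i ∈ s, κ i ≠ 0) → (s.card : ℝ) ≤ n)
    (hle : ∑ i, κ i * a i ^ 2 ≤ ∑ i, κ i * b i ^ 2) (j : ι) (hj : 1 / 16 ≤ κ j) :
    a j ≤ 4 * n * η := by
  classical
  have hη0 : 0 ≤ η := (hb j).trans (hη j (by linarith))
  have h1 : ∑ i, κ i * b i ^ 2 ≤ n * η ^ 2 := by
    rw [← Finset.sum_filter_of_ne (p := fun i => κ i ≠ 0) fun i _ h => left_ne_zero_of_mul h]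
    refine (Finset.sum_le_card_nsmul _ _ (η ^ 2) fun i hi => ?_).trans ?_
    · have h2 := pow_le_pow_left₀ (hb i) (hη i (Finset.mem_filter.1 hi).2) 2
      exact (mul_le_mul (hκ1 i) h2 (sq_nonneg _) zero_le_one).trans_eq (one_mul _)
    · rw [nsmul_eq_mul]
      exact mul_le_mul_of_nonneg_right (hcard _ fun i hi => (Finset.mem_filter.1 hi).2)
        (sq_nonneg _)
  have h2 : κ j * a j ^ 2 ≤ ∑ i, κ i * a i ^ 2 :=
    Finset.single_le_sum (f := fun i => κ i * a i ^ 2)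
      (fun i _ => mul_nonneg (hκ0 i) (sq_nonneg _)) (Finset.mem_univ j)
  have h3 : 1 / 16 * a j ^ 2 ≤ κ j * a j ^ 2 := mul_le_mul_of_nonneg_right hj (sq_nonneg _)
  have h5 : n * η ^ 2 ≤ n ^ 2 * η ^ 2 :=
    mul_le_mul_of_nonneg_right (by nlinarith) (sq_nonneg _)
  refine (pow_le_pow_iff_left₀ (ha j) (by positivity) two_ne_zero).1 ?_
  linarith [show (4 * n * η) ^ 2 = 16 * (n ^ 2 * η ^ 2) by ring]

namespace DualMesh

section
variable {d N : ℕ} {Ω : Set (Vec d)} (M : DualMesh Ω N)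

theorem exists_lsq_minimizer (γ : Finset (Fin N)) (ε : ℝ) (φ : P1Basis d) (z : Vec d)
    (uh : M.Samples γ) : ∃ c, ∀ b, M.lsq γ ε φ z uh c ≤ M.lsq γ ε φ z uh b := by
  -- the weighted residuals as vectors of a Euclidean space
  let w : {i : Fin N // i ∉ γ} → ℝ := fun i => Real.sqrt (kernel ε (dist z (M.pt i)))
  let L : (Fin d × Fin (d + 1) → ℝ) →ₗ[ℝ] PiLp 2 (fun _ : {i : Fin N // i ∉ γ} => Vec d) :=
    { toFun := fun b => WithLp.toLp 2 fun i => w i • ∑ s, b s • φ.vec s (M.pt i)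
      map_add' := fun a b => by
        ext i : 1
        simp [add_smul, Finset.sum_add_distrib]
      map_smul' := fun c b => by
        ext i : 1
        simp only [Pi.smul_apply, smul_eq_mul, mul_smul, ← Finset.smul_sum, RingHom.id_apply,
          PiLp.smul_apply]
        rw [smul_comm] }
  let t : PiLp 2 (fun _ : {i : Fin N // i ∉ γ} => Vec d) := WithLp.toLp 2 fun i => w i • uh i
  have hlsq : ∀ b, M.lsq γ ε φ z uh b = 1 / 2 * ‖t - L b‖ ^ 2 := by
    intro b
    rw [lsq, PiLp.norm_sq_eq_of_L2]
    congr 1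
    refine Finset.sum_congr rfl fun i _ => ?_
    have : (t - L b) i = w i • (uh i - ∑ s, b s • φ.vec s (M.pt i)) := by
      simp [t, L, smul_sub]
    rw [this, norm_smul, mul_pow, Real.norm_eq_abs, sq_abs, Real.sq_sqrt (kernel_nonneg _ _),
      norm_sub_rev]
  obtain ⟨c, hc⟩ := exists_norm_sub_le_of_linearMap L t
  refine ⟨c, fun b => ?_⟩
  rw [hlsq, hlsq]
  have := hc b
  gcongr

theorem lsq_gmls_le (γ : Finset (Fin N)) (ε : ℝ) (φ : P1Basis d) (z : Vec d)
    (uh : M.Samples γ) (b : Fin d × Fin (d + 1) → ℝ) :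
    M.lsq γ ε φ z uh (M.gmls γ ε φ z uh) ≤ M.lsq γ ε φ z uh b :=
  Classical.epsilon_spec (M.exists_lsq_minimizer γ ε φ z uh) b

/-- The GMLS field is as close to the data as any affine field `T`, up to the number `n` of points
in the support of the kernel. -/
theorem norm_gmls_field_sub_le {γ : Finset (Fin N)} {ε : ℝ} (hε : 0 < ε) (φ : P1Basis d)
    (z : Vec d) (u : Vec d → Vec d) (T : Vec d →ᵃ[ℝ] Vec d) {η n : ℝ} (hn : 1 ≤ n)
    (hη : ∀ j, dist z (M.pt j) < ε → ‖u (M.pt j) - T (M.pt j)‖ ≤ η)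
    (hcard : ∀ s : Finset (Fin N), (∀ j ∈ s, dist z (M.pt j) < ε) → (s.card : ℝ) ≤ n)
    {j : Fin N} (hj : j ∉ γ) (hz : dist z (M.pt j) ≤ ε / 2) :
    ‖φ.field (M.gmls γ ε φ z (M.sample γ u)) (M.pt j) - T (M.pt j)‖ ≤ (4 * n + 1) * η := by
  have hjε : dist z (M.pt j) < ε := by linarith
  obtain ⟨b, hb⟩ := φ.exists_field_eq T
  have hmin := M.lsq_gmls_le γ ε φ z (M.sample γ u) b
  simp only [lsq, ← φ.field_apply, hb, sample] at hmin
  generalize φ.field (M.gmls γ ε φ z (M.sample γ u)) = P at hmin ⊢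
  have hmin' : ∑ i : {i : Fin N // i ∉ γ}, kernel ε (dist z (M.pt i)) *
      ‖P (M.pt i) - u (M.pt i)‖ ^ 2 ≤ ∑ i : {i : Fin N // i ∉ γ},
      kernel ε (dist z (M.pt i)) * ‖T (M.pt i) - u (M.pt i)‖ ^ 2 := by
    linarith
  have hker : ∀ i : {i : Fin N // i ∉ γ}, kernel ε (dist z (M.pt i)) ≠ 0 →
      dist z (M.pt i) < ε := fun i hi => not_le.1 fun h => hi (kernel_eq_zero hε h)
  have hη' : ∀ i : {i : Fin N // i ∉ γ}, kernel ε (dist z (M.pt i)) ≠ 0 →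
      ‖T (M.pt i) - u (M.pt i)‖ ≤ η := fun i hi => by
    rw [norm_sub_rev]; exact hη i (hker i hi)
  have hcard' : ∀ s : Finset {i : Fin N // i ∉ γ},
      (∀ i ∈ s, kernel ε (dist z (M.pt i)) ≠ 0) → (s.card : ℝ) ≤ n := fun s hs => by
    rw [← Finset.card_map (Function.Embedding.subtype _)]
    refine hcard _ fun k hk => ?_
    obtain ⟨i, hi, rfl⟩ := Finset.mem_map.1 hk
    exact hker i (hs i hi)
  have h4 := le_of_weighted_sum_sq_le _ _ _ (fun _ => kernel_nonneg _ _)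
    (fun _ => kernel_le_one hε dist_nonneg) (fun _ => norm_nonneg _) (fun _ => norm_nonneg _)
    hη' hn hcard' hmin' ⟨j, hj⟩ (le_kernel hε hz)
  have h6 := hη j hjε
  have h7 := norm_sub_le_norm_sub_add_norm_sub (P (M.pt j)) (u (M.pt j)) (T (M.pt j))
  have h8 : ‖P (M.pt j) - u (M.pt j)‖ ≤ 4 * n * η := h4
  linarith

end

/-! ### Consistency of the discrete divergence on a cell -/

section
variable {m N : ℕ} {Ω : Set (Vec (m + 1))} (M : DualMesh Ω N)

theorem integrableOn_inner_const {F : Set (Vec (m + 1))} (hF : IsCompact F)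
    (hfin : (μHE[m] : Measure (Vec (m + 1))) F < ⊤) {v : Vec (m + 1) → Vec (m + 1)}
    (hv : ContinuousOn v F) (n : Vec (m + 1)) :
    Integrable (fun x => ⟪v x, n⟫) ((μHE[m] : Measure (Vec (m + 1))).restrict F) :=
  (integrableOn_of_continuousOn_compact hF hfin (hv.inner continuousOn_const)).integrable

theorem gmlsFlux_eq_flux (γ : Finset (Fin N)) (ε : ℝ) (φ : P1Basis (m + 1))
    {F : Set (Vec (m + 1))} (hF : IsCompact F) (hfin : (μHE[m] : Measure (Vec (m + 1))) F < ⊤)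
    (n : Vec (m + 1)) (uh : M.Samples γ) :
    M.gmlsFlux γ ε φ F n uh = flux F n (φ.field (M.gmls γ ε φ (centroid F) uh)) := by
  have hvec : ∀ s, Continuous (φ.vec s) := fun s =>
    (AffineMap.continuous_of_finiteDimensional (φ s.2)).smul continuous_const
  simp only [gmlsFlux, flux, φ.field_apply, sum_inner, real_inner_smul_left]
  refine Eq.trans ?_ (integral_finsetSum _ fun s _ =>
    ((integrableOn_inner_const hF hfin (hvec s).continuousOn n).const_mul _)).symm
  exact Finset.sum_congr rfl fun s _ => (integral_const_mul _ _).symm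

theorem abs_flux_sub_flux_le {F : Set (Vec (m + 1))} (hF : IsCompact F) {S E : ℝ} (hS : 0 ≤ S)
    (hE : 0 ≤ E) (hFS : (μHE[m] : Measure (Vec (m + 1))) F ≤ ENNReal.ofReal S) {n : Vec (m + 1)}
    (hn : ‖n‖ = 1) {v w : Vec (m + 1) → Vec (m + 1)} (hv : ContinuousOn v F)
    (hw : ContinuousOn w F) (hvw : ∀ x ∈ F, ‖v x - w x‖ ≤ E) :
    |flux F n v - flux F n w| ≤ E * S := by
  have hfin : (μHE[m] : Measure (Vec (m + 1))) F < ⊤ := hFS.trans_lt ENNReal.ofReal_lt_top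
  have h1 : flux F n v - flux F n w = ∫ x in F, ⟪v x - w x, n⟫ ∂μHE[m] := by
    simp only [inner_sub_left]
    exact (integral_sub (integrableOn_inner_const hF hfin hv n)
      (integrableOn_inner_const hF hfin hw n)).symm
  rw [h1, ← Real.norm_eq_abs]
  refine (norm_setIntegral_le_of_norm_le_const hfin (C := E) fun x hx => ?_).trans ?_
  · exact (norm_inner_le_norm _ _).trans (by rw [hn, mul_one]; exact hvw x hx)
  · refine mul_le_mul_of_nonneg_left ?_ hE
    exact ENNReal.toReal_le_of_le_ofReal hS hFS

/-- The divergence theorem for affine fields on a dual cell. -/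
theorem sum_flux_affine (hΩ : IsLipschitzDomain Ω) (i : Fin N)
    (T : Vec (m + 1) →ᵃ[ℝ] Vec (m + 1)) :
    ∑ j ∈ M.nbr i, flux (M.face i j) (M.normal i j) T +
      (if i ∈ M.bdry then flux (M.bdryFace i) (M.bdryNormal i) T else 0) =
      M.vol i * affineDiv T := by
  classical
  obtain ⟨r, hr, θ, hθ, -, hcone⟩ := hΩ.exists_uniformCone
  have hb : ∀ j, ∃ b : ℝ, j ∈ M.nbr i → ∀ x ∈ M.face i j, ⟪M.normal i j, x⟫ = b := by
    intro j
    by_cases hj : j ∈ M.nbr i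
    · obtain ⟨b, hb⟩ := M.face_affine i j hj
      exact ⟨b, fun _ => hb⟩
    · exact ⟨0, fun h => absurd h hj⟩
  choose b hb using hb
  obtain ⟨b₀, hb₀⟩ : ∃ b₀ : ℝ, i ∈ M.bdry → ∀ x ∈ M.bdryFace i, ⟪M.bdryNormal i, x⟫ = b₀ := by
    by_cases hi : i ∈ M.bdry
    · obtain ⟨b, hb⟩ := M.bdryFace_affine i hi
      exact ⟨b, fun _ => hb⟩
    · exact ⟨0, fun h => absurd h hi⟩
  -- the faces of the cell, with `none` standing for the boundary segment
  let F : Option (Fin N) → Set (Vec (m + 1)) := fun a => a.elim (M.bdryFace i) (M.face i)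
  let n : Option (Fin N) → Vec (m + 1) := fun a => a.elim (M.bdryNormal i) (M.normal i)
  let β : Option (Fin N) → ℝ := fun a => a.elim b₀ b
  let A : Finset (Option (Fin N)) :=
    (M.nbr i).map Function.Embedding.some ∪ if i ∈ M.bdry then {none} else ∅
  have hsome : ∀ j, some j ∈ A ↔ j ∈ M.nbr i := by
    intro j
    simp only [A, Finset.mem_union, Finset.mem_map, Function.Embedding.some_apply,
      Option.some.injEq, exists_eq_right]
    split_ifs <;> simp
  have hnone : none ∈ A ↔ i ∈ M.bdry := by
    simp only [A, Finset.mem_union, Finset.mem_map, Function.Embedding.some_apply]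
    split_ifs with h <;> simp [h]
  have hforall : ∀ p : Option (Fin N) → Prop, (∀ j ∈ M.nbr i, p (some j)) →
      (i ∈ M.bdry → p none) → ∀ a ∈ A, p a := by
    intro p h1 h2 a ha
    cases a with
    | none => exact h2 (hnone.1 ha)
    | some j => exact h1 j ((hsome j).1 ha)
  have hdiv := divergence_flat_faces A (M.isCompact_cell hΩ.isBounded i) F n β
    (hforall _ (fun j _ => M.isCompact_face hΩ.isBounded i j)
      fun _ => M.isCompact_bdryFace hΩ.isBounded i)
    (hforall _ (fun j hj => M.norm_normal hj) fun hi => M.norm_bdryNormal hi)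
    (hforall _ (fun j hj => hb j hj) fun hi => hb₀ hi)
    (by
      intro x hx
      rw [M.frontier_cell i] at hx
      rcases hx with hx | hx
      · simp only [mem_iUnion] at hx
        obtain ⟨j, hj, hxj⟩ := hx
        exact ⟨some j, (hsome j).2 hj, hxj⟩
      · split_ifs at hx with hi
        · exact ⟨none, hnone.2 hi, hx⟩
        · exact absurd hx (notMem_empty x))
    (hforall _ (fun j hj => M.normal_outer i j hj) fun hi => M.bdryNormal_outer i hi)
    (hforall _
      (fun j hj => hforall _
        (fun k hk hjk => M.measure_face_inter_face hj hk fun h => hjk (by rw [h]))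
        fun hi _ => M.measure_face_inter_bdryFace hcone hr hθ hΩ.isOpen hj)
      fun hi => hforall _
        (fun k hk _ => by
          rw [inter_comm]
          exact M.measure_face_inter_bdryFace hcone hr hθ hΩ.isOpen hk)
        fun _ h => absurd rfl h)
    T
  rw [show M.vol i = (volume (M.cell i)).toReal from rfl, ← hdiv, Finset.sum_union, Finset.sum_map]
  · congr 1
    split_ifs <;> simp [F, n]
  · rw [Finset.disjoint_left]
    intro a ha
    obtain ⟨j, -, rfl⟩ := Finset.mem_map.1 ha
    split_ifs <;> simp

/-- If all reconstructions on the faces of a cell are `E`-close to the affine field `T`, and the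
faces have surface measure at most `S`, then the discrete divergence is close to that of `T`. -/
theorem abs_vol_mul_DIV_sub_le (hΩ : IsLipschitzDomain Ω) {γ : Finset (Fin N)} (hγ : γ ⊆ M.bdry)
    (ε : ℝ) (φ : P1Basis (m + 1)) {u : Vec (m + 1) → Vec (m + 1)}
    (hu : ContinuousOn u (closure Ω)) (uh : M.Samples γ) (i : Fin N)
    (T : Vec (m + 1) →ᵃ[ℝ] Vec (m + 1)) {S E : ℝ} (hS : 0 ≤ S) (hE : 0 ≤ E)
    (hSf : ∀ j ∈ M.nbr i, (μHE[m] : Measure (Vec (m + 1))) (M.face i j) ≤ ENNReal.ofReal S)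
    (hSb : i ∈ M.bdry → (μHE[m] : Measure (Vec (m + 1))) (M.bdryFace i) ≤ ENNReal.ofReal S)
    (hEf : ∀ j ∈ M.nbr i, ∀ y ∈ M.cell i,
      ‖φ.field (M.gmls γ ε φ (centroid (M.face i j)) uh) y - T y‖ ≤ E)
    (hEb : i ∈ M.bdry \ γ → ∀ y ∈ M.cell i,
      ‖φ.field (M.gmls γ ε φ (centroid (M.bdryFace i)) uh) y - T y‖ ≤ E)
    (hEu : ∀ y ∈ M.cell i, ‖u y - T y‖ ≤ E) :
    |M.vol i * M.DIV γ ε φ uh u i - M.vol i * affineDiv T| ≤ ((M.nbr i).card + 1) * (E * S) := by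
  have hc : ∀ T : Vec (m + 1) →ᵃ[ℝ] Vec (m + 1), Continuous T := fun T =>
    AffineMap.continuous_of_finiteDimensional T
  rw [M.vol_mul_DIV hΩ.isBounded, ← M.sum_flux_affine hΩ i T]
  have hbdry : |(if i ∈ M.bdry \ γ then
        M.gmlsFlux γ ε φ (M.bdryFace i) (M.bdryNormal i) uh else 0)
      + (if i ∈ γ then flux (M.bdryFace i) (M.bdryNormal i) u else 0)
      - (if i ∈ M.bdry then flux (M.bdryFace i) (M.bdryNormal i) T else 0)| ≤ E * S := by
    by_cases hi : i ∈ M.bdry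
    · have hF := M.isCompact_bdryFace hΩ.isBounded i
      by_cases hiγ : i ∈ γ
      · have h1 : i ∉ M.bdry \ γ := by simp [hiγ]
        rw [if_neg h1, if_pos hiγ, if_pos hi, zero_add]
        exact abs_flux_sub_flux_le hF hS hE (hSb hi) (M.norm_bdryNormal hi)
          (hu.mono ((M.bdryFace_subset_cell i).trans (M.cell_subset_closure i)))
          (hc T).continuousOn fun x hx => hEu x (M.bdryFace_subset_cell i hx)
      · have h1 : i ∈ M.bdry \ γ := by simp [hi, hiγ]
        rw [if_pos h1, if_neg hiγ, if_pos hi, add_zero,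
          M.gmlsFlux_eq_flux γ ε φ hF (M.bdryFace_measure_lt_top hΩ.isBounded hi)]
        exact abs_flux_sub_flux_le hF hS hE (hSb hi) (M.norm_bdryNormal hi)
          (hc _).continuousOn (hc T).continuousOn
          fun x hx => hEb h1 x (M.bdryFace_subset_cell i hx)
    · have h1 : i ∉ M.bdry \ γ := by simp [hi]
      rw [if_neg h1, if_neg fun h => hi (hγ h), if_neg hi]
      simpa using mul_nonneg hE hS
  have hface : |∑ j ∈ M.nbr i, M.gmlsFlux γ ε φ (M.face i j) (M.normal i j) uh
      - ∑ j ∈ M.nbr i, flux (M.face i j) (M.normal i j) T| ≤ (M.nbr i).card * (E * S) := by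
    rw [← Finset.sum_sub_distrib]
    refine (Finset.abs_sum_le_sum_abs _ _).trans ?_
    rw [← nsmul_eq_mul]
    refine Finset.sum_le_card_nsmul _ _ _ fun j hj => ?_
    have hF := M.isCompact_face hΩ.isBounded i j
    rw [M.gmlsFlux_eq_flux γ ε φ hF (M.face_measure_lt_top hΩ.isBounded hj)]
    exact abs_flux_sub_flux_le hF hS hE (hSf j hj) (M.norm_normal hj)
      (hc _).continuousOn (hc T).continuousOn fun x hx => hEf j hj x (M.face_subset_cell i j hx)
  have h3 := abs_add_le
    (∑ j ∈ M.nbr i, M.gmlsFlux γ ε φ (M.face i j) (M.normal i j) uh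
      - ∑ j ∈ M.nbr i, flux (M.face i j) (M.normal i j) T)
    ((if i ∈ M.bdry \ γ then M.gmlsFlux γ ε φ (M.bdryFace i) (M.bdryNormal i) uh else 0)
      + (if i ∈ γ then flux (M.bdryFace i) (M.bdryNormal i) u else 0)
      - (if i ∈ M.bdry then flux (M.bdryFace i) (M.bdryNormal i) T else 0))
  rw [add_mul, one_mul]
  refine le_trans (le_of_eq ?_) (h3.trans (add_le_add hface hbdry))
  congr 1
  ring

theorem ShapeRegular.const_pos {M : DualMesh Ω N} (hΩ : IsLipschitzDomain Ω) {c : ℝ}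
    (hM : M.ShapeRegular c) : 0 < c := by
  obtain ⟨i⟩ := M.nonempty_index hΩ
  have h1 := (hM i).2
  have h2 : 0 < M.fillDist ^ (m + 1) := pow_pos (M.fillDist_pos hΩ) _
  exact pos_of_mul_pos_left (h2.trans_le h1) (M.vol_pos hΩ.isBounded i).le

end

end DualMesh

/-! ### Unisolvency and first-order accuracy -/

namespace DualMesh

variable {m N : ℕ} {Ω : Set (Vec (m + 1))}

/-- The least squares problems are unisolvent, for every choice of `γ`, as soon as the radius `ε` of
the kernel exceeds a multiple of the fill distance `h` and `h` is small. -/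
theorem unisolvent_of_le (M : DualMesh Ω N) (hΩ : IsLipschitzDomain Ω) {r θ : ℝ} (hθ : 0 < θ)
    (hcone : UniformCone Ω r θ) {c D : ℝ} (hS : M.ShapeRegular c) (hcD : c ≤ D) (hD : 0 < D)
    {γ : Finset (Fin N)} (hγ : γ ⊆ M.bdry) (hr : 8 * (m + 1) / θ * M.fillDist ≤ r) {ε : ℝ}
    (hε : 2 * (D + (8 * (m + 1) / θ + 4 * (m + 1) + 1)) * M.fillDist ≤ ε) :
    M.Unisolvent γ ε := by
  have hh := M.fillDist_pos hΩ
  intro z hz p hp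
  obtain ⟨i, hi⟩ := M.exists_dist_anchor_le hΩ.isBounded hS
    (mul_le_mul_of_nonneg_right hcD hh.le) hz
  obtain ⟨y₀, -, hbound⟩ := M.exists_affine_bound hΩ hθ hcone (M.pt_mem_closure i) hr le_rfl
  have hε0 : 0 < ε := lt_of_lt_of_le (by positivity) hε
  have h1 := hbound p 0 fun j hj hji => by
    rw [hp j (fun h => hj (hγ h)) (lt_of_lt_of_le (by norm_num) (le_kernel hε0 ?_)), norm_zero]
    have h2 := dist_triangle z (M.pt i) (M.pt j)
    rw [dist_comm (M.pt i)] at h2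
    linarith
  ext1 y
  have h2 := h1 y
  rw [zero_mul] at h2
  exact norm_le_zero_iff.1 h2

/-- The consistency error of the discrete divergence. The lengths `a h` and `τ h` are the heights in
the cone at which a simplex of interior points resp. the base point of the Taylor expansion are
found. -/
theorem abs_divergence_sub_DIV_le (M : DualMesh Ω N) (hΩ : IsLipschitzDomain Ω) {r θ : ℝ}
    (hr : 0 < r) (hθ : 0 < θ) (hθ1 : θ ≤ 1) (hcone : UniformCone Ω r θ) {cqu creg D K₁ a b τ : ℝ}
    (hQ : M.QuasiUniform cqu) (hS : M.ShapeRegular creg) (hcD : creg ≤ D) (hD : 0 < D)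
    (hK₁ : 0 < K₁) (ha : a = 8 * (m + 1) / θ) (hb : b = a + 4 * (m + 1) + 1)
    (hτ : τ = (D + K₁) / θ) (har : a * M.fillDist ≤ r) (hτr : τ * M.fillDist ≤ r)
    {γ : Finset (Fin N)} (hγ : γ ⊆ M.bdry) {ε : ℝ} (hε : 2 * (D + b) * M.fillDist ≤ ε)
    (hεK : ε ≤ K₁ * M.fillDist) (φ : P1Basis (m + 1)) {u : Vec (m + 1) → Vec (m + 1)}
    (hu : IsC2 Ω u) (i : Fin N) :
    |divergence Ω u (M.pt i) - M.DIV γ ε φ (M.sample γ u) u i| ≤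
      ((m + 1) * τ + creg * ((2 * D * cqu + 1) ^ (m + 1) + 1) *
        ((4 * ((D + K₁) * cqu + 1) ^ (m + 1) + 1) * (3 * τ ^ 2) * (1 + D + b)) *
        (Real.sqrt (m + 1) * D ^ m * (volume (Metric.ball (0 : Vec m) 1)).toReal)) *
      M.fillDist * c2Norm Ω u := by
  have hh := M.fillDist_pos hΩ
  have hcqu := hQ.const_pos hΩ
  have hcreg := hS.const_pos hΩ
  have hB := c2Norm_nonneg Ω u
  have hvi := M.vol_pos hΩ.isBounded i
  set h := M.fillDist with hdef
  set B := c2Norm Ω u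
  have ha0 : 0 < a := by rw [ha]; positivity
  have hb0 : 0 < b := by rw [hb]; positivity
  have hτ0 : 0 < τ := by rw [hτ]; positivity
  have hε0 : 0 < ε := lt_of_lt_of_le (by positivity) hε
  have hθτ : θ * (τ * h) = (D + K₁) * h := by rw [hτ]; field_simp
  have hDh : creg * h ≤ D * h := mul_le_mul_of_nonneg_right hcD hh.le
  have hx := M.pt_mem_closure i
  set x := M.pt i with hxdef
  obtain ⟨T, hT, hdiv⟩ := hu.exists_affine_approx hΩ.isOpen hcone hr hθ hθ1 hx
    (mul_pos hτ0 hh) hτr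
  rw [hθτ] at hT
  set η := 3 * B * (τ * h) ^ 2 with hη
  have hη0 : 0 ≤ η := by positivity
  set n := ((D + K₁) * cqu + 1) ^ (m + 1) with hn
  have hn1 : 1 ≤ n := one_le_pow₀ (by nlinarith [mul_pos (add_pos hD hK₁) hcqu])
  set E := (4 * n + 1) * η * (1 + D + b) with hE
  have hE0 : 0 ≤ E := by positivity
  have hηE : η ≤ E := by
    have h1 : 1 ≤ (4 * n + 1) * (1 + D + b) := by nlinarith
    calc η = 1 * η := (one_mul _).symm
      _ ≤ (4 * n + 1) * (1 + D + b) * η := mul_le_mul_of_nonneg_right h1 hη0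
      _ = E := by rw [hE]; ring
  have hcell := M.cell_subset_closedBall hΩ.isBounded hS hDh i
  obtain ⟨y₀, hy₀, hbound⟩ := M.exists_affine_bound hΩ hθ hcone hx (by rw [← ha]; exact har)
    (ρ := b * h) (by rw [hb, ha])
  -- the reconstruction at any anchor near `x` is close to the Taylor polynomial on the cell
  have hrec : ∀ z, dist z x ≤ D * h → ∀ y ∈ M.cell i,
      ‖φ.field (M.gmls γ ε φ z (M.sample γ u)) y - T y‖ ≤ E := by
    intro z hz y hy
    have hnear : ∀ j, dist z (M.pt j) < ε → dist (M.pt j) x ≤ (D + K₁) * h := fun j hj => by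
      have h1 := dist_triangle (M.pt j) z x
      rw [dist_comm (M.pt j) z] at h1
      linarith
    have h1 := hbound (φ.field (M.gmls γ ε φ z (M.sample γ u)) - T) ((4 * n + 1) * η)
      fun j hj hji => M.norm_gmls_field_sub_le hε0 φ z u T hn1
        (fun k hk => hT _ (M.pt_mem_closure k) (hnear k hk))
        (fun s hs => hQ.card_le hΩ (by positivity) x s fun k hk => hnear k (hs k hk))
        (fun hjγ => hj (hγ hjγ)) (by
          have h2 := dist_triangle z x (M.pt j)
          rw [dist_comm x] at h2
          linarith)
    refine (h1 y).trans ?_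
    refine mul_le_mul_of_nonneg_left ?_ (by positivity)
    have h2 := dist_triangle y x y₀
    rw [dist_comm x] at h2
    have h3 := Metric.mem_closedBall.1 (hcell hy)
    have h4 : dist y y₀ / h ≤ D + b := by
      rw [div_le_iff₀ hh]; linarith
    linarith
  set S := Real.sqrt (m + 1) * (D * h) ^ m * (volume (Metric.ball (0 : Vec m) 1)).toReal with hSdef
  have hS0 : 0 ≤ S := by positivity
  have hmain := M.abs_vol_mul_DIV_sub_le hΩ hγ ε φ hu.continuousOn (M.sample γ u) i T hS0 hE0
    (fun j hj => by
      obtain ⟨b, hb⟩ := M.face_affine i j hj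
      exact euclideanHausdorffMeasure_flat_le (M.norm_normal hj) hb (by positivity)
        ((M.face_subset_cell i j).trans hcell))
    (fun hi => by
      obtain ⟨b, hb⟩ := M.bdryFace_affine i hi
      exact euclideanHausdorffMeasure_flat_le (M.norm_bdryNormal hi) hb (by positivity)
        ((M.bdryFace_subset_cell i).trans hcell))
    (fun j hj => hrec _ (M.centroid_face_mem hΩ.isBounded hS hDh hj))
    (fun hi => hrec _ (M.centroid_bdryFace_mem hΩ.isBounded hS hDh (Finset.mem_sdiff.1 hi).1))
    (fun y hy => (hT y (M.cell_subset_closure i hy) (by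
      have h3 := Metric.mem_closedBall.1 (hcell hy)
      nlinarith)).trans hηE)
  -- neighbouring cells meet, so that their points have distance `O(h)`
  have hcard : ((M.nbr i).card : ℝ) ≤ (2 * D * cqu + 1) ^ (m + 1) := by
    refine hQ.card_le hΩ (by positivity) x _ fun j hj => ?_
    obtain ⟨y, hy⟩ := nonempty_of_measure_ne_zero (M.face_pos i j hj).ne'
    have h1 := Metric.mem_closedBall.1 (hcell (M.face_subset_cell i j hy))
    have h2 := Metric.mem_closedBall.1 (M.cell_subset_closedBall hΩ.isBounded hS hDh j
      (M.face_subset_cell j i (by rw [M.face_comm]; exact hy)))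
    have h3 := dist_triangle_left (M.pt j) x y
    linarith
  have hvol := (hS i).2
  have hDIV : |M.DIV γ ε φ (M.sample γ u) u i - affineDiv T| ≤
      creg * ((2 * D * cqu + 1) ^ (m + 1) + 1) * ((4 * n + 1) * (3 * τ ^ 2) * (1 + D + b)) *
        (Real.sqrt (m + 1) * D ^ m * (volume (Metric.ball (0 : Vec m) 1)).toReal) * h * B := by
    rw [← mul_sub, abs_mul, abs_of_pos hvi] at hmain
    refine le_of_mul_le_mul_left ?_ (pow_pos hh (m + 1))
    calc h ^ (m + 1) * |M.DIV γ ε φ (M.sample γ u) u i - affineDiv T|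
        ≤ creg * M.vol i * |M.DIV γ ε φ (M.sample γ u) u i - affineDiv T| :=
          mul_le_mul_of_nonneg_right hvol (abs_nonneg _)
      _ = creg * (M.vol i * |M.DIV γ ε φ (M.sample γ u) u i - affineDiv T|) := mul_assoc _ _ _
      _ ≤ creg * (((M.nbr i).card + 1) * (E * S)) := mul_le_mul_of_nonneg_left hmain hcreg.le
      _ ≤ creg * (((2 * D * cqu + 1) ^ (m + 1) + 1) * (E * S)) := by gcongr
      _ = _ := by
        rw [hE, hη, hSdef, mul_pow]
        ring
  have htri := abs_sub_le (divergence Ω u x) (affineDiv T) (M.DIV γ ε φ (M.sample γ u) u i)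
  rw [abs_sub_comm (affineDiv T)] at htri
  refine htri.trans ((add_le_add hdiv hDIV).trans (le_of_eq ?_))
  push_cast
  ring

end DualMesh

end MMD

end


open Classical in
theorem theorem4p1 {d : ℕ} (hd : d = 2 ∨ d = 3) {Ω : Set (MMD.Vec d)}
    (hΩ : MMD.IsLipschitzDomain Ω) :
    -- local conservation
    (∀ (N : ℕ) (M : MMD.DualMesh Ω N) (γ : Finset (Fin N)), γ ⊆ M.bdry →
      ∀ ε > 0, M.Unisolvent γ ε → ∀ (φ : MMD.P1Basis d) (uh : M.Samples γ)
        (g : MMD.Vec d → MMD.Vec d) (S : Finset (Fin N)),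
        ∑ i ∈ S, M.vol i * M.DIV γ ε φ uh g i =
          ∑ i ∈ S, ∑ j ∈ M.nbr i with M.face i j ⊆ frontier (⋃ k ∈ S, M.cell k),
              M.gmlsFlux γ ε φ (M.face i j) (M.normal i j) uh
            + ∑ k ∈ S ∩ (M.bdry \ γ), M.gmlsFlux γ ε φ (M.bdryFace k) (M.bdryNormal k) uh
            + ∑ k ∈ S ∩ γ, MMD.flux (M.bdryFace k) (M.bdryNormal k) g) ∧
    -- global conservation
    (∀ (N : ℕ) (M : MMD.DualMesh Ω N), ∀ ε > 0, M.Unisolvent M.bdry ε →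
      ∀ (φ : MMD.P1Basis d) (uh : M.Samples M.bdry) (u : MMD.Vec d → MMD.Vec d),
        ContinuousOn u (frontier Ω) →
        ∑ i, M.vol i * M.DIV M.bdry ε φ uh u i = MMD.boundaryFlux Ω u) ∧
    -- first-order accuracy, with constants that do not depend on the point cloud
    (∀ cqu creg : ℝ, ∃ K₀ > 0, ∀ K₁ ≥ K₀, ∃ h₀ > 0, ∃ C : ℝ,
      ∀ (N : ℕ) (M : MMD.DualMesh Ω N), M.QuasiUniform cqu → M.ShapeRegular creg →
        M.fillDist ≤ h₀ → ∀ γ : Finset (Fin N), γ ⊆ M.bdry →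
        ∀ ε : ℝ, K₀ * M.fillDist ≤ ε → ε ≤ K₁ * M.fillDist →
          M.Unisolvent γ ε ∧
          ∀ (φ : MMD.P1Basis d) (u : MMD.Vec d → MMD.Vec d), MMD.IsC2 Ω u → ∀ i,
            |MMD.divergence Ω u (M.pt i) - M.DIV γ ε φ (M.sample γ u) u i| ≤
              C * M.fillDist * MMD.c2Norm Ω u) := by
  obtain ⟨m, rfl⟩ : ∃ m, d = m + 1 := by
    rcases hd with rfl | rfl
    · exact ⟨1, rfl⟩
    · exact ⟨2, rfl⟩
  refine ⟨fun N M γ _ ε _ _ φ uh g S => ?_, fun N M ε _ _ φ uh u hu => ?_, fun cqu creg => ?_⟩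
  · convert M.sum_vol_mul_DIV hΩ.isBounded γ ε φ uh g S
  · exact M.sum_vol_mul_DIV_univ hΩ ε φ uh hu
  obtain ⟨r, hr, θ, hθ, hθ1, hcone⟩ := hΩ.exists_uniformCone
  set D := max creg 1 with hD
  have hD0 : 0 < D := lt_max_of_lt_right one_pos
  set a : ℝ := 8 * (m + 1) / θ with ha
  have ha0 : 0 < a := by positivity
  set b : ℝ := a + 4 * (m + 1) + 1 with hb
  refine ⟨2 * (D + b), by positivity, fun K₁ hK₁ => ?_⟩
  have hK₁0 : 0 < K₁ := lt_of_lt_of_le (by positivity) hK₁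
  set τ := (D + K₁) / θ with hτ
  have hτ0 : 0 < τ := by positivity
  refine ⟨r / (a + τ), by positivity,
    (m + 1) * τ + creg * ((2 * D * cqu + 1) ^ (m + 1) + 1) *
      ((4 * ((D + K₁) * cqu + 1) ^ (m + 1) + 1) * (3 * τ ^ 2) * (1 + D + b)) *
      (Real.sqrt (m + 1) * D ^ m * (volume (Metric.ball (0 : MMD.Vec m) 1)).toReal),
    fun N M hQ hS hh₀ γ hγ ε hε hεK => ?_⟩
  · have hh := M.fillDist_pos hΩ
    rw [le_div_iff₀ (by positivity)] at hh₀
    have har : a * M.fillDist ≤ r := by nlinarith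
    have hτr : τ * M.fillDist ≤ r := by nlinarith
    exact ⟨M.unisolvent_of_le hΩ hθ hcone hS (le_max_left _ _) hD0 hγ har hε, fun φ u hu i =>
      M.abs_divergence_sub_DIV_le hΩ hr hθ hθ1 hcone hQ hS (le_max_left _ _) hD0 hK₁0 ha hb hτ
        har hτr hγ hε hεK φ hu i⟩
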